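/- Let $M$ be either a hyperbolic surface (a connected Riemannian surface of constant curvature $-1$; completeness is not needed) or a complete connected Riemannian manifold, of any finite dimension, of nonpositive sectional curvature. Write $\operatorname{dist}$ for the Riemannian distance, $d\mathrm{Vol}$ for the Riemannian measure (the area measure on a surface), $B(q;r)=\{z\in M:\operatorname{dist}(z,q)<r\}$, and let $\operatorname{inj}(q)\in(0,\infty]$ be the injectivity radius at $q$, that is, the supremum of the $r$ such that $\exp_q$ maps the open ball of radius $r$ in $T_qM$ diffeomorphically onto an open subset of $M$. Let $p\in M$, and let $\sigma:[0,2\operatorname{inj}(p)]\to M$, parametrized by arc length, be a shortest nontrivial geodesic loop based at $p$ (in particular $\operatorname{inj}(p)<\infty$ and $\sigma(0)=\sigma(2\operatorname{inj}(p))=p$). Assume that $$\inf_{s\in[0,2\operatorname{inj}(p)]}\operatorname{inj}(\sigma(s))\ge 2\varepsilon_0$$ for a constant $\varepsilon_0>0$. Then for every measurable function $f:M\to[0,\infty]$, $$\int_0^{2\operatorname{inj}(p)}\Bigl(\int_{B(\sigma(s);\varepsilon_0)}f\,d\mathrm{Vol}\Bigr)ds\;\le\;12\,\varepsilon_0\int_{\mathcal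 N_{\varepsilon_0}(\sigma)}f\,d\mathrm{Vol},$$ where $\mathcal N_{\varepsilon_0}(\sigma)=\{z\in M:\operatorname{dist}(z,\sigma([0,2\operatorname{inj}(p)]))<\varepsilon_0\}$ (both sides may be $+\infty$). -/

import Mathlib

open Set MeasureTheory
open scoped Bundle Manifold ContDiff ENNReal

noncomputable section

namespace RiemannianNeck

section Coordinates

variable {n : ℕ} {M : Type*} [MetricSpace M] [ChartedSpace (EuclideanSpace ℝ (Fin n)) M]

/-- The coordinate vector field `∂_i` of the chart at `x₀`, at the point with coordinates `y`. -/
def coordVector (x₀ : M) (y : EuclideanSpace ℝ (Fin n)) (i : Fin n) :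
    TangentSpace (𝓡 n) ((extChartAt (𝓡 n) x₀).symm y) :=
  mfderiv (𝓡 n) (𝓡 n) (extChartAt (𝓡 n) x₀).symm y (EuclideanSpace.single i (1 : ℝ))

variable [Bundle.RiemannianBundle (fun x : M => TangentSpace (𝓡 n) x)]

/-- The matrix `g_ij` of the Riemannian metric in the chart at `x₀`. -/
def metricCoeff (x₀ : M) (y : EuclideanSpace ℝ (Fin n)) : Matrix (Fin n) (Fin n) ℝ :=
  Matrix.of fun i j => inner ℝ (coordVector x₀ y i) (coordVector x₀ y j)

/-- The partial derivative `∂_i F` of a function of the coordinates. -/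
def partialD (i : Fin n) (F : EuclideanSpace ℝ (Fin n) → ℝ) (y : EuclideanSpace ℝ (Fin n)) : ℝ :=
  fderiv ℝ F y (EuclideanSpace.single i (1 : ℝ))

/-- The Christoffel symbol `Γ^k_ij` of the Levi-Civita connection in the chart at `x₀`. -/
def christoffel (x₀ : M) (k i j : Fin n) (y : EuclideanSpace ℝ (Fin n)) : ℝ :=
  (1 / 2 : ℝ) * ∑ l, (metricCoeff x₀ y)⁻¹ k l *
    (partialD i (fun z => metricCoeff x₀ z j l) y + partialD j (fun z => metricCoeff x₀ z i l) y
      - partialD l (fun z => metricCoeff x₀ z i j) y)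

/-- The component `R^l_ijk` of the curvature tensor in the chart at `x₀`:
`∇_{∂_i} ∇_{∂_j} ∂_k - ∇_{∂_j} ∇_{∂_i} ∂_k = ∑ l, R^l_ijk ∂_l`. -/
def curvatureCoeff (x₀ : M) (l i j k : Fin n) (y : EuclideanSpace ℝ (Fin n)) : ℝ :=
  partialD i (christoffel x₀ l j k) y - partialD j (christoffel x₀ l i k) y
    + ∑ m, (christoffel x₀ m j k y * christoffel x₀ l i m y
        - christoffel x₀ m i k y * christoffel x₀ l j m y)

/-- The sectional curvature `⟨R(u, v) v, u⟩ / (|u|² |v|² - ⟨u, v⟩²)` of the plane spanned by two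
linearly independent tangent vectors at `x`, computed in the chart at `x`, in which the coordinates
of a tangent vector at `x` are its components in Mathlib's model of the tangent space. -/
def sectionalCurvature (x : M) (u v : TangentSpace (𝓡 n) x) : ℝ :=
  let a : EuclideanSpace ℝ (Fin n) := u
  let b : EuclideanSpace ℝ (Fin n) := v
  let y := extChartAt (𝓡 n) x x
  (∑ i, ∑ j, ∑ k, ∑ l, ∑ m,
      a i * b j * b k * a m * curvatureCoeff x l i j k y * metricCoeff x y l m)
    / (inner ℝ u u * inner ℝ v v - inner ℝ u v ^ 2)

variable (n M) in
/-- Every sectional curvature is nonpositive. -/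
def HasNonposCurvature : Prop :=
  ∀ (x : M) (u v : TangentSpace (𝓡 n) x), LinearIndependent ℝ ![u, v] →
    sectionalCurvature x u v ≤ 0

variable (n M) in
/-- A Riemannian manifold of dimension `2` and of constant curvature `-1`. -/
def IsHyperbolicSurface : Prop :=
  n = 2 ∧ ∀ (x : M) (u v : TangentSpace (𝓡 n) x), LinearIndependent ℝ ![u, v] →
    sectionalCurvature x u v = -1

/-- The Riemannian measure of the domain of the chart at `x₀`: the image of `√(det g) dy`. -/
def chartVolume [MeasurableSpace M] (x₀ : M) : Measure M :=
  ((volume.restrict (extChartAt (𝓡 n) x₀).target).withDensity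
    fun y => ENNReal.ofReal (Real.sqrt (metricCoeff x₀ y).det)).map (extChartAt (𝓡 n) x₀).symm

variable (n M) in
/-- The Riemannian measure. The measures `√(det g) dy` of the charts agree on overlaps, so that
their supremum in the lattice of measures is the measure which restricts to each of them. -/
def riemannianVolume [MeasurableSpace M] : Measure M :=
  ⨆ x₀ : M, chartVolume (n := n) x₀

variable (n) in
/-- `γ` is a geodesic on the interval `s`: it is smooth and in every chart it satisfies
`c_k'' + ∑ i j, Γ^k_ij c_i' c_j' = 0` (with one-sided derivatives at the end points of `s`). -/
def IsGeodesicOn (γ : ℝ → M) (s : Set ℝ) : Prop :=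
  ContMDiffOn 𝓘(ℝ, ℝ) (𝓡 n) ∞ γ s ∧
  ∀ x₀ : M, ∀ t ∈ s, γ t ∈ (chartAt (EuclideanSpace ℝ (Fin n)) x₀).source →
    let c : Fin n → ℝ → ℝ := fun k r => extChartAt (𝓡 n) x₀ (γ r) k
    ∀ k, derivWithin (derivWithin (c k) s) s t
      + ∑ i, ∑ j, christoffel x₀ k i j (extChartAt (𝓡 n) x₀ (γ t))
          * derivWithin (c i) s t * derivWithin (c j) s t = 0

variable (n) in
/-- `q = exp_p(v)`: the geodesic `γ : [0, 1] → M` with `γ(0) = p` and `γ'(0) = v` (an equality of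
components in the chart at `p`) ends at `q`. -/
def IsExp (p : M) (v : EuclideanSpace ℝ (Fin n)) (q : M) : Prop :=
  ∃ γ : ℝ → M, IsGeodesicOn n γ (Icc 0 1) ∧ γ 0 = p ∧
    derivWithin (fun t => extChartAt (𝓡 n) p (γ t)) (Icc 0 1) 0 = v ∧ γ 1 = q

open Classical in
/-- The exponential map at `p` (with value `p` at vectors where it is not defined). -/
def riemannianExp (p : M) (v : EuclideanSpace ℝ (Fin n)) : M :=
  if h : ∃ q, IsExp n p v q then h.choose else p

/-- The open ball of radius `r` about the origin of the tangent space at `p`, for the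
Riemannian norm. -/
def tangentBall (p : M) (r : ℝ≥0∞) : Set (EuclideanSpace ℝ (Fin n)) :=
  {v : TangentSpace (𝓡 n) p | ‖v‖ₑ < r}

variable (n) in
/-- The injectivity radius at `p`: the supremum of the `r` such that `exp_p` restricts to a
diffeomorphism from the open ball of radius `r` in the tangent space onto an open subset. -/
def injRadius (p : M) : ℝ≥0∞ :=
  sSup {r | ∃ Φ : PartialDiffeomorph (𝓡 n) (𝓡 n) (EuclideanSpace ℝ (Fin n)) M ∞,
    Φ.source = tangentBall p r ∧ EqOn Φ (riemannianExp p) (tangentBall p r)}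

variable (n) in
/-- `γ : [0, ℓ] → M` is a nontrivial geodesic loop based at `p`, of length `ℓ`, parametrized by
arc length. -/
def IsGeodesicLoop (γ : ℝ → M) (p : M) (ℓ : ℝ) : Prop :=
  0 < ℓ ∧ IsGeodesicOn n γ (Icc 0 ℓ) ∧
  (∀ t ∈ Icc 0 ℓ, ‖mfderivWithin 𝓘(ℝ, ℝ) (𝓡 n) γ (Icc 0 ℓ) t (1 : ℝ)‖ = 1) ∧
  γ 0 = p ∧ γ ℓ = p

variable (n) in
/-- A nontrivial geodesic loop based at `p` of least length among all of these. -/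
def IsShortestGeodesicLoop (γ : ℝ → M) (p : M) (ℓ : ℝ) : Prop :=
  IsGeodesicLoop n γ p ℓ ∧ ∀ (γ' : ℝ → M) (ℓ' : ℝ), IsGeodesicLoop n γ' p ℓ' → ℓ ≤ ℓ'

end Coordinates

end RiemannianNeck

end

/-!
By Tonelli's theorem the left-hand side is the integral over `z` of `f z` times the measure of the
set of times `s` at which `σ s` is `ε₀`-close to `z` (`setLIntegral_ball_le`), so it is enough to
bound this measure by `12 ε₀`. It is in fact at most `4 ε₀` (`IsGeodesicLoop.volume_close_le`). On
each of the two halves of `σ` the distance to `p` is an affine function of slope `±1` of the time,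
because each half is a geodesic issuing from `p` that is not longer than the injectivity radius.
Two times `s, t` in the same half at which `σ` is `ε₀`-close to `z` hence satisfy
`|s - t| = |dist p (σ s) - dist p (σ t)| ≤ dist (σ s) (σ t) < 2 ε₀`.

The geometric input is that the radial geodesics of a normal ball are shortest paths
(`fiberNorm_le_riemannianEDist`), which rests on the Gauss lemma (`pullMetric_normalBall`). The
Gauss lemma is proved for a metric `G` on a star-shaped open subset of a vector space such that the
rays from the origin are geodesics (`gauss_lemma`). The geodesic equation enters in its
Euler–Lagrange form `d/dt G(c', ·) = ½ dG(·)(c', c')`, which involves no connection and is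
manifestly invariant under changes of coordinates (`radialEulerLagrange_of_pullback`), and which is
obtained from the Christoffel symbols by lowering an index (`metricForm_eulerLagrange`). The rays
of a normal ball are geodesics by the uniqueness of geodesics with a given initial velocity
(`IsGeodesicOn.eqOn`), which follows from the uniqueness of solutions of ordinary differential
equations in charts.
-/

namespace RiemannianNeck

open Filter Topology

/-! ### The Gauss lemma in a vector space -/

section Calculus

variable {E : Type*} [NormedAddCommGroup E] [NormedSpace ℝ E]

/-- A family `G` of bilinear forms on `E`, indexed by the points of `E`, satisfies at `u` the
Euler–Lagrange equation of the energy `½ G c c' c'` for curves `c` that move with constant velocity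
`u`: it says that straight rays through the origin are geodesics at `u`. -/
def RadialEulerLagrange (G : E → E → E → ℝ) (u : E) : Prop :=
  ∀ w, fderiv ℝ (fun x => G x u w) u u = (1 / 2 : ℝ) * fderiv ℝ (fun x => G x u u) u w

/-- `G` is a symmetric bilinear form. -/
structure IsBilinSymm (G : E → E → ℝ) : Prop where
  /-- Additivity in the first argument. -/
  add_left : ∀ a b c, G (a + b) c = G a c + G b c
  /-- Homogeneity in the first argument. -/
  smul_left : ∀ (r : ℝ) a c, G (r • a) c = r * G a c
  /-- Symmetry. -/
  symm : ∀ a b, G a b = G b a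

namespace IsBilinSymm

variable {B : E → E → ℝ} (h : IsBilinSymm B)

include h

lemma add_right (a b c : E) : B a (b + c) = B a b + B a c := by
  rw [h.symm, h.add_left, h.symm b, h.symm c]

lemma smul_right (r : ℝ) (a c : E) : B a (r • c) = r * B a c := by
  rw [h.symm, h.smul_left, h.symm c]

lemma zero_left (a : E) : B 0 a = 0 := by
  have := h.smul_left 0 0 a
  simpa using this

end IsBilinSymm

variable {G : E → E → E → ℝ} {s : Set E}

lemma hasDerivAt_comp_line (hs : IsOpen s) (hG : ∀ a b, DifferentiableOn ℝ (fun x => G x a b) s)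
    (a b v : E) (t : ℝ) (hu : t • v ∈ s) :
    HasDerivAt (fun r : ℝ => G (r • v) a b) (fderiv ℝ (fun x => G x a b) (t • v) v) t := by
  have h1 : HasFDerivAt (fun x => G x a b) (fderiv ℝ (fun x => G x a b) (t • v)) (t • v) :=
    ((hG a b).differentiableAt (hs.mem_nhds hu)).hasFDerivAt
  have h2 : HasDerivAt (fun r : ℝ => r • v) v t := by
    simpa using (hasDerivAt_id t).smul_const v
  exact h1.comp_hasDerivAt t h2

/-- Along a radial geodesic the speed is constant: for `w = v` the Euler–Lagrange equation equates
the derivative of `t ↦ G (t v) v v` with half of itself. -/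
lemma radial_speed_const (hs : IsOpen s) (hst : ∀ u ∈ s, ∀ t ∈ Icc (0 : ℝ) 1, t • u ∈ s)
    (hG : ∀ a b, DifferentiableOn ℝ (fun x => G x a b) s) (hB : ∀ u ∈ s, IsBilinSymm (G u))
    {v : E} (hv : v ∈ s) (hEL : ∀ t ∈ Ioo (0 : ℝ) 1, RadialEulerLagrange G (t • v)) :
    G v v v = G 0 v v := by
  have hder : ∀ t ∈ Icc (0 : ℝ) 1, HasDerivAt (fun r : ℝ => G (r • v) v v)
      (fderiv ℝ (fun x => G x v v) (t • v) v) t := fun t ht =>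
    hasDerivAt_comp_line hs hG v v v t (hst v hv t ht)
  obtain ⟨t, ht, h⟩ := exists_hasDerivAt_eq_slope (fun r : ℝ => G (r • v) v v) _ zero_lt_one
    (fun t ht => (hder t ht).continuousAt.continuousWithinAt)
    (fun t ht => hder t (Ioo_subset_Icc_self ht))
  have hz : fderiv ℝ (fun x => G x v v) (t • v) v = 0 := by
    have hEL' := hEL t ht (t • v)
    have ht0 : t ≠ 0 := ht.1.ne'
    have hev : (fun x => G x (t • v) (t • v)) =ᶠ[𝓝 (t • v)] fun x => t ^ 2 * G x v v := by
      filter_upwards [hs.mem_nhds (hst v hv t (Ioo_subset_Icc_self ht))] with x hx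
      rw [(hB x hx).smul_left, (hB x hx).smul_right]; ring
    have hd := (hG v v).differentiableAt (hs.mem_nhds (hst v hv t (Ioo_subset_Icc_self ht)))
    rw [hev.fderiv_eq, fderiv_const_mul hd] at hEL'
    simp only [smul_apply, map_smul, smul_eq_mul] at hEL'
    have h3 : t ^ 3 * fderiv ℝ (fun x => G x v v) (t • v) v = 0 := by linarith
    exact (mul_eq_zero.1 h3).resolve_left (pow_ne_zero _ ht0)
  rw [hz] at h
  simp at h
  linarith

/-- The **Gauss lemma** for a metric on a star-shaped neighbourhood of the origin of a vector space
for which the rays from the origin are geodesics. -/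
theorem gauss_lemma (hs : IsOpen s) (hst : ∀ u ∈ s, ∀ t ∈ Icc (0 : ℝ) 1, t • u ∈ s)
    (hG : ∀ a b, DifferentiableOn ℝ (fun x => G x a b) s) (hB : ∀ u ∈ s, IsBilinSymm (G u))
    (hEL : ∀ v ∈ s, ∀ t ∈ Ioo (0 : ℝ) 1, RadialEulerLagrange G (t • v))
    {v : E} (hv : v ∈ s) (w : E) : G v v w = G 0 v w := by
  have h0 : (0 : E) ∈ s := by simpa using hst v hv 0 (by simp)
  -- differentiating `G u u u = G 0 u u` at `u = t • v` in the direction `w`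
  have hdiff : ∀ u ∈ s, fderiv ℝ (fun x => G x u u) u w + 2 * G u u w = 2 * G 0 u w := by
    intro u hu
    have hcont : ContinuousAt (fun r : ℝ => u + r • w) 0 := by fun_prop
    have hmem : ∀ᶠ r : ℝ in 𝓝 0, u + r • w ∈ s :=
      hcont.eventually_mem (hs.mem_nhds (by simpa using hu))
    have hline : HasDerivAt (fun r : ℝ => u + r • w) w 0 := by
      simpa using ((hasDerivAt_id (0 : ℝ)).smul_const w).const_add u
    have hc : ∀ a b, HasDerivAt (fun r : ℝ => G (u + r • w) a b)
        (fderiv ℝ (fun x => G x a b) u w) 0 := by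
      intro a b
      have h1 : HasFDerivAt (fun x => G x a b) (fderiv ℝ (fun x => G x a b) u)
          (u + (0 : ℝ) • w) := by
        simpa using ((hG a b).differentiableAt (hs.mem_nhds hu)).hasFDerivAt
      exact h1.comp_hasDerivAt (0 : ℝ) hline
    have hL : HasDerivAt (fun r : ℝ => G (u + r • w) u u + (2 * r) * G (u + r • w) u w
        + r ^ 2 * G (u + r • w) w w) (fderiv ℝ (fun x => G x u u) u w + 2 * G u u w) 0 := by
      have := ((hc u u).add (((hasDerivAt_id (0 : ℝ)).const_mul 2).mul (hc u w))).add
        (((hasDerivAt_id (0 : ℝ)).pow 2).mul (hc w w))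
      exact this.congr_deriv (by simp)
    have hR : HasDerivAt (fun r : ℝ => G 0 u u + (2 * r) * G 0 u w
        + r ^ 2 * G 0 w w) (2 * G 0 u w) 0 := by
      have := ((hasDerivAt_const (0 : ℝ) (G 0 u u)).add
        (((hasDerivAt_id (0 : ℝ)).const_mul 2).mul (hasDerivAt_const (0 : ℝ) (G 0 u w)))).add
        (((hasDerivAt_id (0 : ℝ)).pow 2).mul (hasDerivAt_const (0 : ℝ) (G 0 w w)))
      exact this.congr_deriv (by simp)
    refine hL.unique (hR.congr_of_eventuallyEq ?_)
    filter_upwards [hmem] with r hr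
    have key := radial_speed_const hs hst hG hB hr (hEL _ hr)
    have expand : ∀ x ∈ s, G x (u + r • w) (u + r • w)
        = G x u u + (2 * r) * G x u w + r ^ 2 * G x w w := by
      intro x hx
      have h := hB x hx
      rw [h.add_left, h.add_right, h.add_right, h.smul_left, h.smul_left, h.smul_right,
        h.smul_right, h.symm w u]
      ring
    rw [expand _ hr, expand _ h0] at key
    exact key
  -- the Euler–Lagrange equation and `hdiff` together say that `t ↦ t (G (t v) v w - G 0 v w)` has
  -- zero derivative
  have hder : ∀ t ∈ Icc (0 : ℝ) 1, HasDerivAt (fun r : ℝ => r * (G (r • v) v w - G 0 v w))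
      (1 * (G (t • v) v w - G 0 v w) + t * fderiv ℝ (fun x => G x v w) (t • v) v) t := by
    intro t ht
    exact (hasDerivAt_id t).mul
      ((hasDerivAt_comp_line hs hG v w v t (hst v hv t ht)).sub_const _)
  obtain ⟨t, ht, h⟩ := exists_hasDerivAt_eq_slope (fun r : ℝ => r * (G (r • v) v w - G 0 v w)) _
    zero_lt_one (fun t ht => (hder t ht).continuousAt.continuousWithinAt)
    (fun t ht => hder t (Ioo_subset_Icc_self ht))
  have hz : 1 * (G (t • v) v w - G 0 v w) + t * fderiv ℝ (fun x => G x v w) (t • v) v = 0 := by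
    have hu := hst v hv t (Ioo_subset_Icc_self ht)
    have ht0 : t ≠ 0 := ht.1.ne'
    have hEL' := hEL v hv t ht w
    have h2 := hdiff _ hu
    have hev : (fun x => G x (t • v) w) =ᶠ[𝓝 (t • v)] fun x => t * G x v w := by
      filter_upwards [hs.mem_nhds hu] with x hx
      rw [(hB x hx).smul_left]
    rw [hev.fderiv_eq, fderiv_const_mul ((hG v w).differentiableAt (hs.mem_nhds hu))] at hEL'
    simp only [smul_apply, map_smul, smul_eq_mul] at hEL'
    rw [(hB _ hu).smul_left, (hB _ h0).smul_left] at h2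
    have : t * (1 * (G (t • v) v w - G 0 v w) + t * fderiv ℝ (fun x => G x v w) (t • v) v) = 0 := by
      linarith
    exact (mul_eq_zero.1 this).resolve_left ht0
  rw [hz] at h
  simp at h
  linarith

set_option synthInstance.maxHeartbeats 200000 in
/-- Invariance of the Euler–Lagrange equation under a change of coordinates `H`: if the image under
`H` of the ray in the direction `u` solves the equation of the metric `g` at `H u`, then
the ray solves the equation of the pulled back metric `G`. -/
lemma radialEulerLagrange_of_pullback {F : Type*} [NormedAddCommGroup F] [NormedSpace ℝ F]
    {H : E → F} {g : F → F →L[ℝ] F →L[ℝ] ℝ} {u : E}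
    (hH : ContDiffAt ℝ 2 H u) (hg : DifferentiableAt ℝ g (H u))
    (hsymm : ∀ a b, g (H u) a b = g (H u) b a)
    (hG : ∀ a b, (fun x => G x a b) =ᶠ[𝓝 u] fun x => g (H x) (fderiv ℝ H x a) (fderiv ℝ H x b))
    (hEL : ∀ ζ, fderiv ℝ g (H u) (fderiv ℝ H u u) (fderiv ℝ H u u) ζ
      + g (H u) (fderiv ℝ (fderiv ℝ H) u u u) ζ
      = (1 / 2 : ℝ) * fderiv ℝ g (H u) ζ (fderiv ℝ H u u) (fderiv ℝ H u u)) :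
    RadialEulerLagrange G u := by
  have hH1 : HasFDerivAt H (fderiv ℝ H u) u :=
    (hH.differentiableAt (by norm_num)).hasFDerivAt
  have hH2 : HasFDerivAt (fderiv ℝ H) (fderiv ℝ (fderiv ℝ H) u) u :=
    ((hH.fderiv_right (m := 1) (by norm_num)).differentiableAt (by norm_num)).hasFDerivAt
  have hsym2 : ∀ a b, fderiv ℝ (fderiv ℝ H) u a b = fderiv ℝ (fderiv ℝ H) u b a := by
    have := hH.isSymmSndFDerivAt (by simp)
    exact fun a b => this a b
  have hd : ∀ a b c, fderiv ℝ (fun x => G x a b) u c =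
      fderiv ℝ g (H u) (fderiv ℝ H u c) (fderiv ℝ H u a) (fderiv ℝ H u b)
      + g (H u) (fderiv ℝ (fderiv ℝ H) u c a) (fderiv ℝ H u b)
      + g (H u) (fderiv ℝ H u a) (fderiv ℝ (fderiv ℝ H) u c b) := by
    intro a b c
    rw [(hG a b).fderiv_eq]
    have h1 : HasFDerivAt (fun x => g (H x)) ((fderiv ℝ g (H u)).comp (fderiv ℝ H u)) u :=
      HasFDerivAt.comp (g := g) (f := H) u hg.hasFDerivAt hH1
    have h2 := fun a : E => hH2.clm_apply (hasFDerivAt_const a u)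
    have h3 := (h1.clm_apply (h2 a)).clm_apply (h2 b)
    rw [h3.fderiv]
    simp
    ring
  intro w
  rw [hd, hd]
  have := hEL (fderiv ℝ H u w)
  rw [hsym2 w u, hsymm (fderiv ℝ (fderiv ℝ H) u u w)]
  linarith

end Calculus

/-! ### The metric in coordinates -/

section Metric

variable {n : ℕ} {M : Type*} [MetricSpace M] [ChartedSpace (EuclideanSpace ℝ (Fin n)) M]
  [Bundle.RiemannianBundle (fun x : M => TangentSpace (𝓡 n) x)]

/-- The pullback of the Riemannian metric under a map `F` from the coordinate space to `M`, at the
point `u`, evaluated at the vectors `a` and `b`. -/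
noncomputable def pullMetric (F : EuclideanSpace ℝ (Fin n) → M)
    (u a b : EuclideanSpace ℝ (Fin n)) : ℝ :=
  inner ℝ (mfderiv (𝓡 n) (𝓡 n) F u a) (mfderiv (𝓡 n) (𝓡 n) F u b)

lemma isBilinSymm_pullMetric (F : EuclideanSpace ℝ (Fin n) → M) (u : EuclideanSpace ℝ (Fin n)) :
    IsBilinSymm (pullMetric F u) where
  add_left a b c := by
    have : mfderiv (𝓡 n) (𝓡 n) F u (a + b)
        = mfderiv (𝓡 n) (𝓡 n) F u a + mfderiv (𝓡 n) (𝓡 n) F u b :=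
      map_add _ a b
    simp only [pullMetric]
    rw [← inner_add_left]
    exact congrArg (fun z => inner ℝ z _) this
  smul_left r a c := by
    have : mfderiv (𝓡 n) (𝓡 n) F u (r • a) = r • mfderiv (𝓡 n) (𝓡 n) F u a :=
      map_smul _ r a
    simp only [pullMetric]
    rw [← real_inner_smul_left]
    exact congrArg (fun z => inner ℝ z _) this
  symm a b := real_inner_comm _ _

lemma pullMetric_self (F : EuclideanSpace ℝ (Fin n) → M) (u a : EuclideanSpace ℝ (Fin n)) :
    pullMetric F u a a = ‖mfderiv (𝓡 n) (𝓡 n) F u a‖ ^ 2 :=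
  real_inner_self_eq_norm_sq _

lemma pullMetric_congr {F F' : EuclideanSpace ℝ (Fin n) → M} {u : EuclideanSpace ℝ (Fin n)}
    (h : F' =ᶠ[𝓝 u] F) (a b : EuclideanSpace ℝ (Fin n)) :
    pullMetric F' u a b = pullMetric F u a b := by
  -- the fibres over `F' u` and `F u` are different types, whose elements are compared in `ℝⁿ`
  have key : ∀ (q q' : M) (D D' : EuclideanSpace ℝ (Fin n) → EuclideanSpace ℝ (Fin n)),
      q = q' → D = D' → @inner ℝ (TangentSpace (𝓡 n) q) _ (D a) (D b)
        = @inner ℝ (TangentSpace (𝓡 n) q') _ (D' a) (D' b) := by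
    rintro q _ D _ rfl rfl; rfl
  refine key (F' u) (F u) (fun v => mfderiv (𝓡 n) (𝓡 n) F' u v)
    (fun v => mfderiv (𝓡 n) (𝓡 n) F u v) h.eq_of_nhds ?_
  have := h.mfderiv_eq (I := 𝓡 n) (I' := 𝓡 n)
  exact congrArg (fun (L : EuclideanSpace ℝ (Fin n) →L[ℝ] EuclideanSpace ℝ (Fin n)) v => L v) this

lemma abs_pullMetric_le (F : EuclideanSpace ℝ (Fin n) → M) (u a b : EuclideanSpace ℝ (Fin n)) :
    |pullMetric F u a b| ≤ ‖mfderiv (𝓡 n) (𝓡 n) F u a‖ * ‖mfderiv (𝓡 n) (𝓡 n) F u b‖ :=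
  abs_real_inner_le_norm _ _

lemma metricCoeff_apply (x₀ : M) (y : EuclideanSpace ℝ (Fin n)) (i j : Fin n) :
    metricCoeff x₀ y i j = pullMetric (extChartAt (𝓡 n) x₀).symm y
      (EuclideanSpace.single i 1) (EuclideanSpace.single j 1) := rfl

lemma metricCoeff_comm (x₀ : M) (y : EuclideanSpace ℝ (Fin n)) (i j : Fin n) :
    metricCoeff x₀ y i j = metricCoeff x₀ y j i := by
  rw [metricCoeff_apply, metricCoeff_apply, (isBilinSymm_pullMetric _ y).symm]

lemma IsBilinSymm.sum_left {E : Type*} [NormedAddCommGroup E] [NormedSpace ℝ E] {B : E → E → ℝ}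
    (h : IsBilinSymm B) {ι : Type*} (s : Finset ι) (f : ι → E) (c : E) :
    B (∑ i ∈ s, f i) c = ∑ i ∈ s, B (f i) c := by
  classical
  induction s using Finset.induction_on with
  | empty => simp [h.zero_left]
  | insert i s hi ih => rw [Finset.sum_insert hi, Finset.sum_insert hi, h.add_left, ih]

lemma IsBilinSymm.eq_sum {B : EuclideanSpace ℝ (Fin n) → EuclideanSpace ℝ (Fin n) → ℝ}
    (h : IsBilinSymm B) (a b : EuclideanSpace ℝ (Fin n)) :
    B a b = ∑ i, ∑ j, B (EuclideanSpace.single i 1) (EuclideanSpace.single j 1) * a i * b j := by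
  have ha : ∀ a : EuclideanSpace ℝ (Fin n), a = ∑ i, a i • EuclideanSpace.single i (1 : ℝ) := by
    intro a
    ext j
    simp [Finset.sum_apply, Pi.single_apply]
  have h1 : ∀ a c, B a c = ∑ i, a i * B (EuclideanSpace.single i 1) c := by
    intro a c
    conv_lhs => rw [ha a, h.sum_left]
    simp_rw [h.smul_left]
  rw [h1]
  refine Finset.sum_congr rfl fun i _ => ?_
  rw [h.symm, h1, Finset.mul_sum]
  refine Finset.sum_congr rfl fun j _ => ?_
  rw [h.symm]; ring

lemma pullMetric_symm_eq_sum (x₀ : M) (y a b : EuclideanSpace ℝ (Fin n)) :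
    pullMetric (extChartAt (𝓡 n) x₀).symm y a b = ∑ i, ∑ j, metricCoeff x₀ y i j * a i * b j :=
  (isBilinSymm_pullMetric _ y).eq_sum a b

variable [IsManifold (𝓡 n) ∞ M]

omit [Bundle.RiemannianBundle (fun x : M => TangentSpace (𝓡 n) x)] in
lemma mdifferentiableAt_extChartAt_symm (x₀ : M) {y : EuclideanSpace ℝ (Fin n)}
    (hy : y ∈ (extChartAt (𝓡 n) x₀).target) :
    MDifferentiableAt (𝓡 n) (𝓡 n) (extChartAt (𝓡 n) x₀).symm y :=
  ((contMDiffOn_extChartAt_symm (n := ∞) x₀).contMDiffAt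
    ((isOpen_extChartAt_target x₀).mem_nhds hy)).mdifferentiableAt (by simp)

/-- The pullback metric is computed in a chart. -/
lemma pullMetric_eq_chart {F : EuclideanSpace ℝ (Fin n) → M} {u : EuclideanSpace ℝ (Fin n)} (x₀ : M)
    (hF : MDifferentiableAt (𝓡 n) (𝓡 n) F u) (hu : F u ∈ (extChartAt (𝓡 n) x₀).source)
    (a b : EuclideanSpace ℝ (Fin n)) :
    pullMetric F u a b = pullMetric (extChartAt (𝓡 n) x₀).symm (extChartAt (𝓡 n) x₀ (F u))
      (fderiv ℝ (fun x => extChartAt (𝓡 n) x₀ (F x)) u a)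
      (fderiv ℝ (fun x => extChartAt (𝓡 n) x₀ (F x)) u b) := by
  have hφ : MDifferentiableAt (𝓡 n) (𝓡 n) (extChartAt (𝓡 n) x₀) (F u) :=
    mdifferentiableAt_extChartAt (by simpa using hu)
  have hH : MDifferentiableAt (𝓡 n) (𝓡 n) (fun x => extChartAt (𝓡 n) x₀ (F x)) u :=
    hφ.comp u hF
  have hs := mdifferentiableAt_extChartAt_symm x₀ ((extChartAt (𝓡 n) x₀).map_source hu)
  have hcomp : mfderiv (𝓡 n) (𝓡 n)
      ((extChartAt (𝓡 n) x₀).symm ∘ fun x => extChartAt (𝓡 n) x₀ (F x)) u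
      = (mfderiv (𝓡 n) (𝓡 n) (extChartAt (𝓡 n) x₀).symm (extChartAt (𝓡 n) x₀ (F u))).comp
        (mfderiv (𝓡 n) (𝓡 n) (fun x => extChartAt (𝓡 n) x₀ (F x)) u) :=
    mfderiv_comp u hs hH
  have hev : ((extChartAt (𝓡 n) x₀).symm ∘ fun x => extChartAt (𝓡 n) x₀ (F x)) =ᶠ[𝓝 u] F := by
    filter_upwards [hF.continuousAt.eventually_mem
      ((isOpen_extChartAt_source x₀).mem_nhds hu)] with x hx
    exact (extChartAt (𝓡 n) x₀).left_inv hx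
  rw [← pullMetric_congr hev]
  unfold pullMetric
  rw [hcomp]
  rw [mfderiv_eq_fderiv]
  rfl

variable [IsContMDiffRiemannianBundle (𝓡 n) ∞ (EuclideanSpace ℝ (Fin n))
      (fun x : M => TangentSpace (𝓡 n) x)]

/-- The vector field `u ↦ dF_u a` along `F` is the tangent map of `F` applied to a constant vector
field, and the metric is smooth. -/
lemma contDiffOn_pullMetric {F : EuclideanSpace ℝ (Fin n) → M}
    {s : Set (EuclideanSpace ℝ (Fin n))}
    (hs : IsOpen s) (hF : ContMDiffOn (𝓡 n) (𝓡 n) ∞ F s) (a b : EuclideanSpace ℝ (Fin n)) :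
    ContDiffOn ℝ ∞ (fun u => pullMetric F u a b) s := by
  have hsec : ∀ a : EuclideanSpace ℝ (Fin n), ContMDiffOn (𝓡 n) (𝓡 n).tangent ∞
      (fun u => (⟨F u, mfderiv (𝓡 n) (𝓡 n) F u a⟩ : TangentBundle (𝓡 n) M)) s := by
    intro a
    have h1 := hF.contMDiffOn_tangentMapWithin (m := ∞) (by simp) hs.uniqueMDiffOn
    have h2 : ContMDiffOn (𝓡 n) (𝓡 n).tangent ∞
        (fun u : EuclideanSpace ℝ (Fin n) =>
          (⟨u, a⟩ : TangentBundle (𝓡 n) (EuclideanSpace ℝ (Fin n)))) s :=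
      contMDiffOn_vectorSpace_iff_contDiffOn.2 contDiffOn_const
    have h3 := h1.comp h2 (fun u hu => hu)
    refine h3.congr fun u hu => ?_
    simp only [Function.comp, tangentMapWithin]
    rw [mfderivWithin_of_isOpen hs hu]
  rw [← contMDiffOn_iff_contDiffOn]
  exact ContMDiffOn.inner_bundle (hsec a) (hsec b)

lemma contDiffOn_metricCoeff (x₀ : M) (i j : Fin n) :
    ContDiffOn ℝ ∞ (fun y => metricCoeff x₀ y i j) (extChartAt (𝓡 n) x₀).target :=
  contDiffOn_pullMetric (isOpen_extChartAt_target x₀) (contMDiffOn_extChartAt_symm x₀) _ _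

end Metric

/-! ### Christoffel symbols and the Euler–Lagrange equation -/

section Christoffel

lemma contDiffOn_matrix_det {E : Type*} [NormedAddCommGroup E] [NormedSpace ℝ E] {m : ℕ}
    {A : E → Matrix (Fin m) (Fin m) ℝ} {s : Set E} {k : WithTop ℕ∞}
    (hA : ∀ i j, ContDiffOn ℝ k (fun y => A y i j) s) : ContDiffOn ℝ k (fun y => (A y).det) s := by
  simp only [Matrix.det_apply]
  refine ContDiffOn.sum fun σ _ => ?_
  have : ContDiffOn ℝ k (fun y => ∏ i, A y (σ i) i) s := contDiffOn_prod fun i _ => hA _ _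
  exact this.const_smul (Equiv.Perm.sign σ : ℤˣ)

lemma contDiffOn_matrix_inv {E : Type*} [NormedAddCommGroup E] [NormedSpace ℝ E] {m : ℕ}
    {A : E → Matrix (Fin m) (Fin m) ℝ} {s : Set E} {k : WithTop ℕ∞}
    (hA : ∀ i j, ContDiffOn ℝ k (fun y => A y i j) s) (hdet : ∀ y ∈ s, (A y).det ≠ 0)
    (i j : Fin m) :
    ContDiffOn ℝ k (fun y => (A y)⁻¹ i j) s := by
  have h1 : ContDiffOn ℝ k (fun y => (A y).det⁻¹ * (A y).adjugate i j) s := by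
    refine ((contDiffOn_matrix_det hA).inv hdet).mul ?_
    simp only [Matrix.adjugate_apply]
    refine contDiffOn_matrix_det fun a b => ?_
    by_cases h : a = j
    · subst h
      simp only [Matrix.updateRow_self]
      exact contDiffOn_const
    · simp only [Matrix.updateRow_ne h]
      exact hA a b
  refine h1.congr fun y hy => ?_
  simp [Matrix.inv_def, Ring.inverse_eq_inv']

lemma hasFDerivAt_sum_smul {E V : Type*} [NormedAddCommGroup E] [NormedSpace ℝ E]
    [NormedAddCommGroup V] [NormedSpace ℝ V] {m : ℕ} {c : Fin m → Fin m → E → ℝ}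
    {c' : Fin m → Fin m → E →L[ℝ] ℝ} {y : E} (hc : ∀ i j, HasFDerivAt (c i j) (c' i j) y)
    (T : Fin m → Fin m → V) :
    HasFDerivAt (fun z => ∑ i, ∑ j, c i j z • T i j) (∑ i, ∑ j, (c' i j).smulRight (T i j)) y :=
  HasFDerivAt.fun_sum fun i _ => HasFDerivAt.fun_sum fun j _ => (hc i j).smul_const (T i j)

variable {n : ℕ} {M : Type*} [MetricSpace M] [ChartedSpace (EuclideanSpace ℝ (Fin n)) M]
  [Bundle.RiemannianBundle (fun x : M => TangentSpace (𝓡 n) x)]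
  [IsManifold (𝓡 n) ∞ M]

lemma metricCoeff_det_ne_zero (x₀ : M) {y : EuclideanSpace ℝ (Fin n)}
    (hy : y ∈ (extChartAt (𝓡 n) x₀).target) : (metricCoeff x₀ y).det ≠ 0 := by
  intro h0
  obtain ⟨v, hv, hv0⟩ := Matrix.exists_mulVec_eq_zero_iff.2 h0
  have : IsManifold (𝓡 n) 1 M := IsManifold.of_le (n := ∞) (by simp)
  have hinv := isInvertible_mfderivWithin_extChartAt_symm (I := 𝓡 n) (x := x₀) hy
  rw [ModelWithCorners.range_eq_univ, mfderivWithin_univ] at hinv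
  set a : EuclideanSpace ℝ (Fin n) := WithLp.toLp 2 v with ha
  have h1 : pullMetric (extChartAt (𝓡 n) x₀).symm y a a = 0 := by
    rw [pullMetric_symm_eq_sum]
    refine Finset.sum_eq_zero fun i _ => ?_
    have h2 := congrFun hv0 i
    simp only [Matrix.mulVec, dotProduct, Pi.zero_apply] at h2
    calc _ = (∑ j, metricCoeff x₀ y i j * v j) * v i := by
            rw [Finset.sum_mul]; refine Finset.sum_congr rfl fun j _ => ?_
            simp only [ha]; ring
      _ = 0 := by rw [h2, zero_mul]
  rw [pullMetric_self] at h1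
  have h2 : mfderiv (𝓡 n) (𝓡 n) (extChartAt (𝓡 n) x₀).symm y a = 0 :=
    norm_eq_zero.1 (pow_eq_zero_iff two_ne_zero |>.1 h1)
  have h3 : a = 0 := hinv.injective (by rw [h2]; exact (map_zero _).symm)
  exact hv (by simpa [ha] using h3)

/-- Lowering the upper index of the Christoffel symbols cancels the inverse of the metric. -/
lemma sum_metricCoeff_mul_christoffel (x₀ : M) {y : EuclideanSpace ℝ (Fin n)}
    (hy : y ∈ (extChartAt (𝓡 n) x₀).target) (l i j : Fin n) :
    ∑ k, metricCoeff x₀ y l k * christoffel x₀ k i j y = (1 / 2 : ℝ) *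
      (partialD i (fun z => metricCoeff x₀ z j l) y + partialD j (fun z => metricCoeff x₀ z i l) y
        - partialD l (fun z => metricCoeff x₀ z i j) y) := by
  have hunit : IsUnit (metricCoeff x₀ y).det := (metricCoeff_det_ne_zero x₀ hy).isUnit
  have hmul := Matrix.mul_nonsing_inv _ hunit
  set c : Fin n → ℝ := fun l => partialD i (fun z => metricCoeff x₀ z j l) y
    + partialD j (fun z => metricCoeff x₀ z i l) y - partialD l (fun z => metricCoeff x₀ z i j) y
  have h1 : ∀ k, christoffel x₀ k i j y = (1 / 2 : ℝ) * ((metricCoeff x₀ y)⁻¹.mulVec c) k :=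
    fun k => rfl
  have h2 : (metricCoeff x₀ y).mulVec ((metricCoeff x₀ y)⁻¹.mulVec c) = c := by
    rw [Matrix.mulVec_mulVec, hmul, Matrix.one_mulVec]
  calc _ = (1 / 2 : ℝ) * ((metricCoeff x₀ y).mulVec ((metricCoeff x₀ y)⁻¹.mulVec c)) l := by
        simp only [h1, Matrix.mulVec, dotProduct, Finset.mul_sum]
        refine Finset.sum_congr rfl fun k _ => Finset.sum_congr rfl fun m _ => by ring
    _ = _ := by rw [h2]

variable [IsContMDiffRiemannianBundle (𝓡 n) ∞ (EuclideanSpace ℝ (Fin n))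
      (fun x : M => TangentSpace (𝓡 n) x)]

lemma contDiffOn_christoffel (x₀ : M) (k i j : Fin n) :
    ContDiffOn ℝ ∞ (christoffel x₀ k i j) (extChartAt (𝓡 n) x₀).target := by
  have hp : ∀ i j l, ContDiffOn ℝ ∞ (partialD i (fun z => metricCoeff x₀ z j l))
      (extChartAt (𝓡 n) x₀).target := by
    intro i j l
    have h1 := (contDiffOn_metricCoeff x₀ j l).fderiv_of_isOpen (m := ∞)
      (isOpen_extChartAt_target x₀) (by simp)
    exact h1.clm_apply contDiffOn_const
  unfold christoffel
  refine contDiffOn_const.mul (ContDiffOn.sum fun l _ => ?_)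
  refine (contDiffOn_matrix_inv (contDiffOn_metricCoeff x₀)
    (fun y hy => metricCoeff_det_ne_zero x₀ hy) k l).mul ?_
  exact ((hp _ _ _).add (hp _ _ _)).sub (hp _ _ _)

omit [IsManifold (𝓡 n) ∞ M] [IsContMDiffRiemannianBundle (𝓡 n) ∞ (EuclideanSpace ℝ (Fin n))
      (fun x : M => TangentSpace (𝓡 n) x)] in
/-- The Riemannian metric in the chart at `x₀`, as a function with values in the continuous bilinear
forms. -/
noncomputable def metricForm (x₀ : M) (y : EuclideanSpace ℝ (Fin n)) :
    EuclideanSpace ℝ (Fin n) →L[ℝ] EuclideanSpace ℝ (Fin n) →L[ℝ] ℝ :=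
  ∑ i, ∑ j, metricCoeff x₀ y i j •
    ((EuclideanSpace.proj i : EuclideanSpace ℝ (Fin n) →L[ℝ] ℝ).smulRight
      (EuclideanSpace.proj j : EuclideanSpace ℝ (Fin n) →L[ℝ] ℝ))

omit [IsManifold (𝓡 n) ∞ M] [IsContMDiffRiemannianBundle (𝓡 n) ∞ (EuclideanSpace ℝ (Fin n))
      (fun x : M => TangentSpace (𝓡 n) x)] in
lemma metricForm_apply (x₀ : M) (y a b : EuclideanSpace ℝ (Fin n)) :
    metricForm x₀ y a b = ∑ i, ∑ j, metricCoeff x₀ y i j * a i * b j := by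
  simp [metricForm, sum_apply, mul_assoc]

set_option synthInstance.maxHeartbeats 400000 in
lemma differentiableAt_metricForm (x₀ : M) {y : EuclideanSpace ℝ (Fin n)}
    (hy : y ∈ (extChartAt (𝓡 n) x₀).target) :
    DifferentiableAt ℝ (metricForm x₀) y ∧ ∀ c a b, fderiv ℝ (metricForm x₀) y c a b
      = ∑ i, ∑ j, fderiv ℝ (fun z => metricCoeff x₀ z i j) y c * a i * b j := by
  have hd : ∀ i j, HasFDerivAt (fun z => metricCoeff x₀ z i j)
      (fderiv ℝ (fun z => metricCoeff x₀ z i j) y) y := fun i j =>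
    (((contDiffOn_metricCoeff x₀ i j).differentiableOn (by simp)).differentiableAt
      ((isOpen_extChartAt_target x₀).mem_nhds hy)).hasFDerivAt
  have h' : HasFDerivAt (metricForm x₀) _ y := hasFDerivAt_sum_smul hd fun i j =>
    (EuclideanSpace.proj i : EuclideanSpace ℝ (Fin n) →L[ℝ] ℝ).smulRight
      (EuclideanSpace.proj j : EuclideanSpace ℝ (Fin n) →L[ℝ] ℝ)
  refine ⟨h'.differentiableAt, fun c a b => ?_⟩
  rw [h'.fderiv]
  simp [sum_apply, mul_assoc]

/-- The geodesic equation, with the index lowered, is the Euler–Lagrange equation of the energy. -/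
lemma metricForm_eulerLagrange (x₀ : M) {y x' x'' : EuclideanSpace ℝ (Fin n)}
    (hy : y ∈ (extChartAt (𝓡 n) x₀).target)
    (hgeo : ∀ k, x'' k + ∑ i, ∑ j, christoffel x₀ k i j y * x' i * x' j = 0)
    (ζ : EuclideanSpace ℝ (Fin n)) :
    fderiv ℝ (metricForm x₀) y x' x' ζ + metricForm x₀ y x'' ζ
      = (1 / 2 : ℝ) * fderiv ℝ (metricForm x₀) y ζ x' x' := by
  have hexp : ∀ (f : EuclideanSpace ℝ (Fin n) →L[ℝ] ℝ) (c : EuclideanSpace ℝ (Fin n)),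
      f c = ∑ l, f (EuclideanSpace.single l 1) * c l := by
    intro f c
    have hc : c = ∑ i, c i • EuclideanSpace.single i (1 : ℝ) := by
      ext j
      simp [Finset.sum_apply, Pi.single_apply]
    conv_lhs => rw [hc, map_sum]
    refine Finset.sum_congr rfl fun l _ => ?_
    rw [map_smul, smul_eq_mul, mul_comm]
  have hD := (differentiableAt_metricForm x₀ hy).2
  -- `d l i j` is the partial derivative `∂_l g_ij`
  set d : Fin n → Fin n → Fin n → ℝ := fun l i j => partialD l (fun z => metricCoeff x₀ z i j) y
  have hd : ∀ c i j, fderiv ℝ (fun z => metricCoeff x₀ z i j) y c = ∑ l, d l i j * c l :=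
    fun c i j => hexp _ c
  have h1 : metricForm x₀ y x'' ζ = -∑ l, (∑ i, ∑ j, (1 / 2 : ℝ) *
      (d i j l + d j i l - d l i j) * x' i * x' j) * ζ l := by
    rw [metricForm_apply, Finset.sum_comm, ← Finset.sum_neg_distrib]
    refine Finset.sum_congr rfl fun l _ => ?_
    have h2 : ∀ k, x'' k = -∑ i, ∑ j, christoffel x₀ k i j y * x' i * x' j := fun k => by
      linarith [hgeo k]
    rw [← Finset.sum_mul, ← neg_mul]
    congr 1
    simp only [d, ← sum_metricCoeff_mul_christoffel x₀ hy, h2, mul_neg, Finset.sum_neg_distrib,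
      Finset.mul_sum, Finset.sum_mul]
    congr 1
    rw [Finset.sum_comm]
    refine Finset.sum_congr rfl fun i _ => ?_
    rw [Finset.sum_comm]
    refine Finset.sum_congr rfl fun j _ => Finset.sum_congr rfl fun k _ => ?_
    rw [metricCoeff_comm x₀ y k l]
    ring
  have hA : fderiv ℝ (metricForm x₀) y x' x' ζ = ∑ l, (∑ i, ∑ j, d i j l * x' i * x' j) * ζ l := by
    rw [hD, Finset.sum_comm]
    refine Finset.sum_congr rfl fun l _ => ?_
    simp only [hd, Finset.sum_mul]
    conv_rhs => rw [Finset.sum_comm]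
  have hA' : fderiv ℝ (metricForm x₀) y x' x' ζ = ∑ l, (∑ i, ∑ j, d j i l * x' i * x' j) * ζ l := by
    rw [hA]
    refine Finset.sum_congr rfl fun l _ => ?_
    rw [Finset.sum_comm]
    congr 1
    refine Finset.sum_congr rfl fun i _ => Finset.sum_congr rfl fun j _ => by ring
  have hC : fderiv ℝ (metricForm x₀) y ζ x' x' = ∑ l, (∑ i, ∑ j, d l i j * x' i * x' j) * ζ l := by
    rw [hD]
    simp only [hd, Finset.sum_mul]
    conv_rhs => rw [Finset.sum_comm]
    refine Finset.sum_congr rfl fun i _ => ?_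
    rw [Finset.sum_comm]
    refine Finset.sum_congr rfl fun j _ => Finset.sum_congr rfl fun k _ => by ring
  have h3 : ∑ l, (∑ i, ∑ j, (1 / 2 : ℝ) * (d i j l + d j i l - d l i j) * x' i * x' j) * ζ l
      = (1 / 2 : ℝ) * (∑ l, (∑ i, ∑ j, d i j l * x' i * x' j) * ζ l
        + ∑ l, (∑ i, ∑ j, d j i l * x' i * x' j) * ζ l
        - ∑ l, (∑ i, ∑ j, d l i j * x' i * x' j) * ζ l) := by
    rw [← Finset.sum_add_distrib, ← Finset.sum_sub_distrib, Finset.mul_sum]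
    refine Finset.sum_congr rfl fun l _ => ?_
    rw [← add_mul, ← sub_mul, ← mul_assoc]
    congr 1
    rw [← Finset.sum_add_distrib, ← Finset.sum_sub_distrib, Finset.mul_sum]
    refine Finset.sum_congr rfl fun i _ => ?_
    rw [← Finset.sum_add_distrib, ← Finset.sum_sub_distrib, Finset.mul_sum]
    refine Finset.sum_congr rfl fun j _ => by ring
  rw [h1, h3, ← hA, ← hA', ← hC]
  ring

end Christoffel

/-! ### Reparametrization and the geodesic equation as a first order system -/

section AffineReparam

variable {F : Type*} [NormedAddCommGroup F] [NormedSpace ℝ F]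

lemma ContDiffWithinAt.derivWithin_two {f : ℝ → F} {s : Set ℝ} {t : ℝ} (hs : UniqueDiffOn ℝ s)
    (ht : t ∈ s) (hf : ContDiffWithinAt ℝ 2 f s t) :
    ContDiffWithinAt ℝ 1 (derivWithin f s) s t := by
  have h := hf.fderivWithin_right (m := 1) hs (by norm_num) ht
  have := h.clm_apply (contDiffWithinAt_const (c := (1 : ℝ)))
  simpa only [fderivWithin_derivWithin] using this

lemma derivWithin_comp_affine {f : ℝ → F} {s s' : Set ℝ} {t α β : ℝ} (hs' : UniqueDiffOn ℝ s')
    (hmaps : MapsTo (fun r => α * r + β) s' s) (ht : t ∈ s')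
    (hf : DifferentiableWithinAt ℝ f s (α * t + β)) :
    derivWithin (fun r => f (α * r + β)) s' t = α • derivWithin f s (α * t + β) := by
  have h1 : HasDerivWithinAt (fun r => α * r + β) α s' t := by
    simpa using ((hasDerivWithinAt_id t s').const_mul α).add_const β
  exact (hf.hasDerivWithinAt.scomp t h1 hmaps).derivWithin (hs' t ht)

lemma derivWithin_derivWithin_comp_affine {f : ℝ → F} {s s' : Set ℝ} {t α β : ℝ}
    (hs : UniqueDiffOn ℝ s) (hs' : UniqueDiffOn ℝ s')
    (hmaps : MapsTo (fun r => α * r + β) s' s) (ht : t ∈ s')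
    (hf : ContDiffWithinAt ℝ 2 f s (α * t + β)) :
    derivWithin (derivWithin (fun r => f (α * r + β)) s') s' t
      = α ^ 2 • derivWithin (derivWithin f s) s (α * t + β) := by
  have hev : ∀ᶠ u in 𝓝[s] (α * t + β), DifferentiableWithinAt ℝ f s u := by
    have h := hf.eventually (by simp)
    rw [insert_eq_of_mem (hmaps ht)] at h
    exact h.mono fun u hu => hu.differentiableWithinAt (by norm_num)
  have htend : Tendsto (fun r => α * r + β) (𝓝[s'] t) (𝓝[s] (α * t + β)) :=
    tendsto_nhdsWithin_iff.2 ⟨(Continuous.tendsto (by fun_prop) t).mono_left nhdsWithin_le_nhds,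
      eventually_nhdsWithin_of_forall hmaps⟩
  have h1 : derivWithin (fun r => f (α * r + β)) s' =ᶠ[𝓝[s'] t]
      fun r => α • derivWithin f s (α * r + β) := by
    filter_upwards [htend.eventually hev, self_mem_nhdsWithin] with r hr hrs
    exact derivWithin_comp_affine hs' hmaps hrs hr
  have hd : DifferentiableWithinAt ℝ (derivWithin f s) s (α * t + β) :=
    (ContDiffWithinAt.derivWithin_two hs (hmaps ht) hf).differentiableWithinAt (by norm_num)
  rw [h1.derivWithin_eq_of_mem ht]
  have h2 : HasDerivWithinAt (fun r => α * r + β) α s' t := by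
    simpa using ((hasDerivWithinAt_id t s').const_mul α).add_const β
  have h3 := (hd.hasDerivWithinAt.scomp t h2 hmaps).const_smul α
  rw [sq, mul_smul]
  exact h3.derivWithin (hs' t ht)

end AffineReparam

section Geodesic

variable {n : ℕ} {M : Type*} [MetricSpace M] [ChartedSpace (EuclideanSpace ℝ (Fin n)) M]

lemma contDiffWithinAt_chart [IsManifold (𝓡 n) ∞ M] {γ : ℝ → M} {s : Set ℝ} {t : ℝ} (x₀ : M)
    (hγ : ContMDiffWithinAt 𝓘(ℝ, ℝ) (𝓡 n) ∞ γ s t) (ht : γ t ∈ (extChartAt (𝓡 n) x₀).source) :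
    ContDiffWithinAt ℝ ∞ (fun r => extChartAt (𝓡 n) x₀ (γ r)) s t := by
  rw [← contMDiffWithinAt_iff_contDiffWithinAt]
  have h1 : ContMDiffAt (𝓡 n) (𝓡 n) ∞ (extChartAt (𝓡 n) x₀) (γ t) :=
    contMDiffAt_extChartAt' (by simpa using ht)
  exact h1.comp_contMDiffWithinAt t hγ

lemma derivWithin_coord {x : ℝ → EuclideanSpace ℝ (Fin n)} {s : Set ℝ} {t : ℝ}
    (hs : UniqueDiffWithinAt ℝ s t) (hx : DifferentiableWithinAt ℝ x s t) (k : Fin n) :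
    derivWithin (fun r => x r k) s t = derivWithin x s t k := by
  have := (EuclideanSpace.proj k :
    EuclideanSpace ℝ (Fin n) →L[ℝ] ℝ).hasFDerivAt.comp_hasDerivWithinAt t hx.hasDerivWithinAt
  exact this.derivWithin hs

variable [Bundle.RiemannianBundle (fun x : M => TangentSpace (𝓡 n) x)] [IsManifold (𝓡 n) ∞ M]

/-- An affine change of parameter, possibly constant or orientation-reversing, preserves geodesics:
both terms of the equation are multiplied by `α²`. -/
lemma IsGeodesicOn.comp_affine {γ : ℝ → M} {s s' : Set ℝ} {α β : ℝ} (h : IsGeodesicOn n γ s)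
    (hs : UniqueDiffOn ℝ s) (hs' : UniqueDiffOn ℝ s')
    (hmaps : MapsTo (fun r => α * r + β) s' s) :
    IsGeodesicOn n (fun r => γ (α * r + β)) s' := by
  refine ⟨?_, fun x₀ t ht hx₀ => ?_⟩
  · have h1 : ContMDiffOn 𝓘(ℝ, ℝ) 𝓘(ℝ, ℝ) ∞ (fun r : ℝ => α * r + β) s' :=
      (ContDiff.contDiffOn (by fun_prop)).contMDiffOn
    exact h.1.comp h1 hmaps
  · intro c k
    have h2 : ∀ k, ContDiffWithinAt ℝ 2 (fun r => extChartAt (𝓡 n) x₀ (γ r) k) s (α * t + β) := by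
      intro k
      have := (contDiffWithinAt_chart x₀ (h.1 _ (hmaps ht)) (by simpa using hx₀)).of_le
        (m := 2) ENat.LEInfty.out
      exact (EuclideanSpace.proj k :
        EuclideanSpace ℝ (Fin n) →L[ℝ] ℝ).contDiff.comp_contDiffWithinAt this
    have hgeo := h.2 x₀ (α * t + β) (hmaps ht) hx₀ k
    have e1 : ∀ k, derivWithin (c k) s' t
        = α * derivWithin (fun r => extChartAt (𝓡 n) x₀ (γ r) k) s (α * t + β) := fun k =>
      derivWithin_comp_affine (f := fun r => extChartAt (𝓡 n) x₀ (γ r) k) hs' hmaps ht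
        ((h2 k).differentiableWithinAt (by norm_num))
    have e2 : derivWithin (derivWithin (c k) s') s' t = α ^ 2 *
        derivWithin (derivWithin (fun r => extChartAt (𝓡 n) x₀ (γ r) k) s) s (α * t + β) :=
      derivWithin_derivWithin_comp_affine (f := fun r => extChartAt (𝓡 n) x₀ (γ r) k) hs hs' hmaps
        ht
        (h2 k)
    simp only [e1, e2]
    have : ∀ a : ℝ, ∀ S : ℝ, a + S = 0 → α ^ 2 * a + α ^ 2 * S = 0 := fun a S h => by
      rw [← mul_add, h, mul_zero]
    have h3 := this _ _ hgeo
    simp only [Finset.mul_sum] at h3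
    refine Eq.trans ?_ h3
    congr 1
    refine Finset.sum_congr rfl fun i _ => Finset.sum_congr rfl fun j _ => by ring

/-- The vector with components `∑ i j, Γ^k_ij a_i a_j`. -/
noncomputable def christoffelQuad (x₀ : M) (y a : EuclideanSpace ℝ (Fin n)) :
    EuclideanSpace ℝ (Fin n) :=
  WithLp.toLp 2 fun k => ∑ i, ∑ j, christoffel x₀ k i j y * a i * a j

/-- The geodesic equation as a first order system for the position and the velocity. -/
lemma IsGeodesicOn.hasDerivWithinAt {γ : ℝ → M} {s : Set ℝ} (h : IsGeodesicOn n γ s)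
    (hs : UniqueDiffOn ℝ s) (x₀ : M) {t : ℝ} (ht : t ∈ s)
    (hx₀ : γ t ∈ (extChartAt (𝓡 n) x₀).source) :
    HasDerivWithinAt (fun r => ((extChartAt (𝓡 n) x₀ (γ r),
        derivWithin (fun r => extChartAt (𝓡 n) x₀ (γ r)) s r) :
          EuclideanSpace ℝ (Fin n) × EuclideanSpace ℝ (Fin n)))
      (derivWithin (fun r => extChartAt (𝓡 n) x₀ (γ r)) s t,
        -christoffelQuad x₀ (extChartAt (𝓡 n) x₀ (γ t))
          (derivWithin (fun r => extChartAt (𝓡 n) x₀ (γ r)) s t)) s t := by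
  set x : ℝ → EuclideanSpace ℝ (Fin n) := fun r => extChartAt (𝓡 n) x₀ (γ r) with hx
  have hc : ContDiffWithinAt ℝ 2 x s t :=
    (contDiffWithinAt_chart x₀ (h.1 _ ht) hx₀).of_le ENat.LEInfty.out
  have hd : DifferentiableWithinAt ℝ x s t := hc.differentiableWithinAt (by norm_num)
  have hd2 : DifferentiableWithinAt ℝ (derivWithin x s) s t :=
    (ContDiffWithinAt.derivWithin_two hs ht hc).differentiableWithinAt (by norm_num)
  have hev : ∀ᶠ u in 𝓝[s] t, DifferentiableWithinAt ℝ x s u := by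
    have h := hc.eventually (by simp)
    rw [insert_eq_of_mem ht] at h
    exact h.mono fun u hu => hu.differentiableWithinAt (by norm_num)
  refine hd.hasDerivWithinAt.prodMk (hd2.hasDerivWithinAt.congr_deriv ?_)
  ext k
  have hgeo := h.2 x₀ t ht (by simpa using hx₀) k
  have e1 : ∀ k, derivWithin (fun r => x r k) s t = derivWithin x s t k := fun k =>
    derivWithin_coord (hs t ht) hd k
  have e2 : derivWithin (derivWithin (fun r => x r k) s) s t
      = derivWithin (derivWithin x s) s t k := by
    rw [← derivWithin_coord (hs t ht) hd2 k]
    refine EventuallyEq.derivWithin_eq_of_mem ?_ ht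
    filter_upwards [hev, self_mem_nhdsWithin] with u hu hus
    exact derivWithin_coord (hs u hus) hu k
  change derivWithin (derivWithin (fun r => x r k) s) s t + ∑ i, ∑ j,
    christoffel x₀ k i j (x t) * derivWithin (fun r => x r i) s t * derivWithin (fun r => x r j) s t
      = 0 at hgeo
  simp only [e1, e2] at hgeo
  simp only [christoffelQuad, PiLp.neg_apply]
  linarith

end Geodesic

/-! ### Uniqueness of geodesics -/

section Uniqueness

variable {n : ℕ} {M : Type*} [MetricSpace M] [ChartedSpace (EuclideanSpace ℝ (Fin n)) M]
variable [Bundle.RiemannianBundle (fun x : M => TangentSpace (𝓡 n) x)] [IsManifold (𝓡 n) ∞ M]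
  [IsContMDiffRiemannianBundle (𝓡 n) ∞ (EuclideanSpace ℝ (Fin n))
      (fun x : M => TangentSpace (𝓡 n) x)]

/-- The vector field of the geodesic equation is locally Lipschitz. -/
lemma exists_lipschitzOnWith_geodesic (x₀ : M) {y a : EuclideanSpace ℝ (Fin n)}
    (hy : y ∈ (extChartAt (𝓡 n) x₀).target) :
    ∃ K : NNReal, ∃ t ∈ 𝓝 ((y, a) : EuclideanSpace ℝ (Fin n) × EuclideanSpace ℝ (Fin n)),
      LipschitzOnWith K (fun z : EuclideanSpace ℝ (Fin n) × EuclideanSpace ℝ (Fin n) =>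
        (z.2, -christoffelQuad x₀ z.1 z.2)) t := by
  apply ContDiffAt.exists_lipschitzOnWith (𝕂 := ℝ)
  refine contDiffAt_snd.prodMk (ContDiffAt.neg ?_)
  rw [contDiffAt_euclidean]
  intro k
  simp only [christoffelQuad]
  have hΓ : ∀ i j, ContDiffAt ℝ 1 (fun z : EuclideanSpace ℝ (Fin n) × EuclideanSpace ℝ (Fin n) =>
      christoffel x₀ k i j z.1) (y, a) := fun i j => by
    have h1 : ContDiffAt ℝ 1 (christoffel x₀ k i j) y :=
      ((contDiffOn_christoffel x₀ k i j).contDiffAt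
        ((isOpen_extChartAt_target x₀).mem_nhds hy)).of_le ENat.LEInfty.out
    exact ContDiffAt.comp (y, a) (f := Prod.fst) h1 contDiffAt_fst
  have hc : ∀ i, ContDiffAt ℝ 1 (fun z : EuclideanSpace ℝ (Fin n) × EuclideanSpace ℝ (Fin n) =>
      z.2 i) (y, a) := fun i =>
    (EuclideanSpace.proj i : EuclideanSpace ℝ (Fin n) →L[ℝ] ℝ).contDiff.contDiffAt.comp (y, a)
      contDiffAt_snd
  exact ContDiffAt.sum fun i _ => ContDiffAt.sum fun j _ => ((hΓ i j).mul (hc i)).mul (hc j)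

/-- Two geodesics with the same position and velocity at `t` agree shortly after `t`. -/
lemma IsGeodesicOn.eqOn_Icc_right {γ₁ γ₂ : ℝ → M} {l t : ℝ} (h₁ : IsGeodesicOn n γ₁ (Icc 0 l))
    (h₂ : IsGeodesicOn n γ₂ (Icc 0 l)) (ht : t ∈ Ico 0 l) (heq : γ₁ t = γ₂ t)
    (hvel : derivWithin (fun r => extChartAt (𝓡 n) (γ₁ t) (γ₁ r)) (Icc 0 l) t
      = derivWithin (fun r => extChartAt (𝓡 n) (γ₁ t) (γ₂ r)) (Icc 0 l) t) :
    ∃ δ > t, EqOn γ₁ γ₂ (Icc t δ) := by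
  have hl : (0 : ℝ) < l := ht.1.trans_lt ht.2
  have hu : UniqueDiffOn ℝ (Icc 0 l) := uniqueDiffOn_Icc hl
  have htI : t ∈ Icc 0 l := Ico_subset_Icc_self ht
  set q := γ₁ t with hq
  have hsrc : q ∈ (extChartAt (𝓡 n) q).source := mem_extChartAt_source q
  obtain ⟨K, N, hN, hLip⟩ := exists_lipschitzOnWith_geodesic q
    (a := derivWithin (fun r => extChartAt (𝓡 n) q (γ₁ r)) (Icc 0 l) t)
    ((extChartAt (𝓡 n) q).map_source hsrc)
  have key : ∀ γ : ℝ → M, IsGeodesicOn n γ (Icc 0 l) → γ t = q →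
      derivWithin (fun r => extChartAt (𝓡 n) q (γ r)) (Icc 0 l) t
        = derivWithin (fun r => extChartAt (𝓡 n) q (γ₁ r)) (Icc 0 l) t →
      ∀ᶠ r in 𝓝[Icc 0 l] t, γ r ∈ (extChartAt (𝓡 n) q).source ∧
        (extChartAt (𝓡 n) q (γ r),
          derivWithin (fun r => extChartAt (𝓡 n) q (γ r)) (Icc 0 l) r) ∈ N := by
    intro γ hγ hγt hγv
    refine Filter.Eventually.and ?_ ?_
    · have hc : ContinuousWithinAt γ (Icc 0 l) t := (hγ.1 t htI).continuousWithinAt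
      exact hc.eventually_mem (by rw [hγt]; exact (isOpen_extChartAt_source q).mem_nhds hsrc)
    · have hc := (hγ.hasDerivWithinAt hu q htI (by rw [hγt]; exact hsrc)).continuousWithinAt
      refine hc.eventually_mem ?_
      beta_reduce
      rw [hγv, hγt]
      exact hN
  have hall := (key γ₁ h₁ rfl rfl).and (key γ₂ h₂ heq.symm hvel.symm)
  have hIcc : Icc 0 l ∈ 𝓝[≥] t := Icc_mem_nhdsGE_of_mem ht
  rw [eventually_nhdsWithin_iff, Metric.eventually_nhds_iff] at hall
  obtain ⟨ε, hε, hall⟩ := hall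
  refine ⟨min (t + ε / 2) l, lt_min (by linarith) ht.2, ?_⟩
  set δ := min (t + ε / 2) l
  have hδ1 : δ ≤ t + ε / 2 := min_le_left _ _
  have hδ2 : δ ≤ l := min_le_right _ _
  have hmem : ∀ r ∈ Icc t δ, r ∈ Icc 0 l := fun r hr => ⟨ht.1.trans hr.1, hr.2.trans hδ2⟩
  have hprop := fun r (hr : r ∈ Icc t δ) => hall (y := r) (by
    rw [Real.dist_eq, abs_lt]; constructor <;> linarith [hr.1, hr.2]) (hmem r hr)
  have hder : ∀ γ : ℝ → M, IsGeodesicOn n γ (Icc 0 l) →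
      (∀ r ∈ Icc t δ, γ r ∈ (extChartAt (𝓡 n) q).source) → ∀ r ∈ Icc t δ, _ :=
    fun γ hγ hs r hr => hγ.hasDerivWithinAt hu q (hmem r hr) (hs r hr)
  have hd1 := hder γ₁ h₁ fun r hr => (hprop r hr).1.1
  have hd2 := hder γ₂ h₂ fun r hr => (hprop r hr).2.1
  have hIci : ∀ r ∈ Ico t δ, Icc 0 l ∈ 𝓝[≥] r := fun r hr =>
    Icc_mem_nhdsGE_of_mem ⟨ht.1.trans hr.1, hr.2.trans_le hδ2⟩
  have hsub : Icc t δ ⊆ Icc 0 l := hmem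
  have hODE := ODE_solution_unique_of_mem_Icc_right
    (v := fun _ (z : EuclideanSpace ℝ (Fin n) × EuclideanSpace ℝ (Fin n)) =>
      (z.2, -christoffelQuad q z.1 z.2)) (s := fun _ => N) (K := K) (a := t) (b := δ)
    (fun _ _ => hLip)
    (fun r hr => (hd1 r hr).continuousWithinAt.mono hsub)
    (fun r hr => (hd1 r (Ico_subset_Icc_self hr)).mono_of_mem_nhdsWithin (hIci r hr))
    (fun r hr => (hprop r (Ico_subset_Icc_self hr)).1.2)
    (fun r hr => (hd2 r hr).continuousWithinAt.mono hsub)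
    (fun r hr => (hd2 r (Ico_subset_Icc_self hr)).mono_of_mem_nhdsWithin (hIci r hr))
    (fun r hr => (hprop r (Ico_subset_Icc_self hr)).2.2)
    (by rw [hvel, ← heq])
  intro r hr
  exact (extChartAt (𝓡 n) q).injOn (hprop r hr).1.1 (hprop r hr).2.1 (congrArg Prod.fst (hODE hr))

/-- A geodesic is determined by its initial position and velocity. -/
theorem IsGeodesicOn.eqOn {γ₁ γ₂ : ℝ → M} {l : ℝ} (hl : 0 < l) (h₁ : IsGeodesicOn n γ₁ (Icc 0 l))
    (h₂ : IsGeodesicOn n γ₂ (Icc 0 l)) (h0 : γ₁ 0 = γ₂ 0)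
    (hv : derivWithin (fun r => extChartAt (𝓡 n) (γ₁ 0) (γ₁ r)) (Icc 0 l) 0
      = derivWithin (fun r => extChartAt (𝓡 n) (γ₁ 0) (γ₂ r)) (Icc 0 l) 0) :
    EqOn γ₁ γ₂ (Icc 0 l) := by
  have hu : UniqueDiffOn ℝ (Icc 0 l) := uniqueDiffOn_Icc hl
  have hc1 : ContinuousOn γ₁ (Icc 0 l) := h₁.1.continuousOn
  have hc2 : ContinuousOn γ₂ (Icc 0 l) := h₂.1.continuousOn
  have hclosed : IsClosed ({t | γ₁ t = γ₂ t} ∩ Icc 0 l) := by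
    have := (hc1.prodMk hc2).preimage_isClosed_of_isClosed isClosed_Icc isClosed_diagonal
    rwa [inter_comm] at this
  -- the set of times up to which the curves agree
  set S : Set ℝ := {t | EqOn γ₁ γ₂ (Icc 0 t)} with hS
  have hSclosed : IsClosed (S ∩ Icc 0 l) := by
    rw [← isSeqClosed_iff_isClosed]
    intro u t hu' hlim
    have htI : t ∈ Icc 0 l :=
      isClosed_Icc.mem_of_tendsto hlim (Eventually.of_forall fun k => (hu' k).2)
    refine ⟨fun r hr => ?_, htI⟩
    rcases hr.2.lt_or_eq with hlt | rfl
    · obtain ⟨k, hk⟩ := (hlim.eventually_const_lt hlt).exists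
      exact (hu' k).1 ⟨hr.1, hk.le⟩
    · exact (hclosed.mem_of_tendsto hlim
        (Eventually.of_forall fun k => ⟨(hu' k).1 ⟨(hu' k).2.1, le_rfl⟩, (hu' k).2⟩)).1
  have hsub : Icc 0 l ⊆ S := by
    refine hSclosed.Icc_subset_of_forall_exists_gt ?_ ?_
    · intro r hr
      have : r = 0 := le_antisymm hr.2 hr.1
      rw [this, h0]
    · rintro t ⟨htS, ht⟩ y hy
      have htI : t ∈ Icc 0 l := Ico_subset_Icc_self ht
      have heq : γ₁ t = γ₂ t := htS ⟨ht.1, le_rfl⟩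
      have hvel : derivWithin (fun r => extChartAt (𝓡 n) (γ₁ t) (γ₁ r)) (Icc 0 l) t
          = derivWithin (fun r => extChartAt (𝓡 n) (γ₁ t) (γ₂ r)) (Icc 0 l) t := by
        rcases ht.1.eq_or_lt with rfl | hpos
        · exact hv
        -- the derivatives are limits of difference quotients from the left
        have hut : UniqueDiffWithinAt ℝ (Icc 0 t) t := uniqueDiffOn_Icc hpos t ⟨hpos.le, le_rfl⟩
        have hs : Icc 0 t ⊆ Icc 0 l := Icc_subset_Icc_right ht.2.le
        have hd1 := (contDiffWithinAt_chart (γ₁ t) (h₁.1 t htI)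
          (mem_extChartAt_source _)).differentiableWithinAt (by simp)
        have hd2 := (contDiffWithinAt_chart (γ₁ t) (h₂.1 t htI)
          (by rw [heq]; exact mem_extChartAt_source _)).differentiableWithinAt (by simp)
        rw [← derivWithin_subset hs hut hd1, ← derivWithin_subset hs hut hd2]
        exact derivWithin_congr (fun r hr => by simp only [htS hr]) (by simp only [heq])
      obtain ⟨δ, hδ, hE⟩ := h₁.eqOn_Icc_right h₂ ht heq hvel
      refine ⟨min δ y, fun r hr => ?_, lt_min hδ hy, min_le_right _ _⟩
      rcases le_total r t with hrt | hrt
      · exact htS ⟨hr.1, hrt⟩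
      · exact hE ⟨hrt, hr.2.trans (min_le_left _ _)⟩
  exact hsub ⟨hl.le, le_rfl⟩

lemma IsExp.unique {p : M} {v : EuclideanSpace ℝ (Fin n)} {q q' : M} (h : IsExp n p v q)
    (h' : IsExp n p v q') : q = q' := by
  obtain ⟨γ, hγ, rfl, hv, rfl⟩ := h
  obtain ⟨γ', hγ', h0, hv', rfl⟩ := h'
  exact hγ.eqOn zero_lt_one hγ' h0.symm (hv.trans hv'.symm) ⟨zero_le_one, le_rfl⟩

lemma IsExp.riemannianExp_eq {p : M} {v : EuclideanSpace ℝ (Fin n)} {q : M} (h : IsExp n p v q) :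
    riemannianExp p v = q := by
  have hex : ∃ q, IsExp n p v q := ⟨q, h⟩
  unfold riemannianExp
  rw [dif_pos hex]
  exact hex.choose_spec.unique h

omit [IsContMDiffRiemannianBundle (𝓡 n) ∞ (EuclideanSpace ℝ (Fin n))
      (fun x : M => TangentSpace (𝓡 n) x)] in
/-- A geodesic starting at `p` with velocity `v` reaches `exp_p (t v)` at time `t`. -/
lemma IsGeodesicOn.isExp_smul {γ : ℝ → M} {l t : ℝ} (hl : 0 < l) (h : IsGeodesicOn n γ (Icc 0 l))
    (ht : t ∈ Icc 0 l) :
    IsExp n (γ 0) (t • derivWithin (fun r => extChartAt (𝓡 n) (γ 0) (γ r)) (Icc 0 l) 0) (γ t) := by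
  have hmaps : MapsTo (fun r => t * r + 0) (Icc (0 : ℝ) 1) (Icc 0 l) := fun r hr =>
    ⟨by nlinarith [hr.1, ht.1], by nlinarith [hr.1, hr.2, ht.1, ht.2]⟩
  have hu : UniqueDiffOn ℝ (Icc (0 : ℝ) 1) := uniqueDiffOn_Icc zero_lt_one
  refine ⟨fun r => γ (t * r + 0), h.comp_affine (uniqueDiffOn_Icc hl) hu hmaps, by simp, ?_,
    by simp⟩
  have hd := (contDiffWithinAt_chart (γ 0) (h.1 0 ⟨le_rfl, hl.le⟩)
    (mem_extChartAt_source _)).differentiableWithinAt (by simp)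
  have := derivWithin_comp_affine (f := fun r => extChartAt (𝓡 n) (γ 0) (γ r)) (t := 0) hu hmaps
    ⟨le_rfl, zero_le_one⟩ (by simpa using hd)
  simpa using this

end Uniqueness

/-! ### The Gauss lemma in a normal ball -/

section NormalBall

variable {n : ℕ} {M : Type*} [MetricSpace M] [ChartedSpace (EuclideanSpace ℝ (Fin n)) M]
variable [Bundle.RiemannianBundle (fun x : M => TangentSpace (𝓡 n) x)]

/-- The inner product of the tangent space at `p`, evaluated at vectors of the coordinate space. -/
noncomputable def fiberInner (p : M) (a b : EuclideanSpace ℝ (Fin n)) : ℝ :=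
  @inner ℝ (TangentSpace (𝓡 n) p) _ a b

lemma isBilinSymm_fiberInner (p : M) : IsBilinSymm (fiberInner (n := n) p) where
  add_left a b c := inner_add_left (E := TangentSpace (𝓡 n) p) (𝕜 := ℝ) a b c
  smul_left r a c := real_inner_smul_left (F := TangentSpace (𝓡 n) p) a c r
  symm a b := real_inner_comm (F := TangentSpace (𝓡 n) p) b a

lemma smul_mem_tangentBall {p : M} {r : ℝ≥0∞} {v : EuclideanSpace ℝ (Fin n)}
    (hv : v ∈ tangentBall p r) {t : ℝ} (ht : t ∈ Icc (0 : ℝ) 1) : t • v ∈ tangentBall p r := by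
  have h1 : @enorm (TangentSpace (𝓡 n) p) _ (t • v) = ‖t‖ₑ * @enorm (TangentSpace (𝓡 n) p) _ v :=
    enorm_smul (β := TangentSpace (𝓡 n) p) t v
  change @enorm (TangentSpace (𝓡 n) p) _ (t • v) < r
  rw [h1]
  refine lt_of_le_of_lt ?_ hv
  calc _ ≤ 1 * @enorm (TangentSpace (𝓡 n) p) _ v := by
        gcongr
        rw [← ofReal_norm, Real.norm_of_nonneg ht.1]
        exact ENNReal.ofReal_le_one.2 ht.2
    _ = _ := one_mul _

lemma zero_mem_tangentBall {p : M} {r : ℝ≥0∞} {v : EuclideanSpace ℝ (Fin n)}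
    (hv : v ∈ tangentBall p r) :
    (0 : EuclideanSpace ℝ (Fin n)) ∈ tangentBall p r := by
  simpa using smul_mem_tangentBall hv (t := 0) (by simp)

lemma isExp_zero (p : M) : IsExp n p 0 p := by
  refine ⟨fun _ => p, ⟨contMDiffOn_const, ?_⟩, rfl, by simp, rfl⟩
  intro x₀ t _ _ c k
  have hc : ∀ k, c k = fun _ => extChartAt (𝓡 n) x₀ p k := fun k => rfl
  simp [hc]

variable {p : M} {r : ℝ≥0∞} {Φ : PartialDiffeomorph (𝓡 n) (𝓡 n) (EuclideanSpace ℝ (Fin n)) M ∞}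

lemma normalBall_mdifferentiableAt (hΦ : Φ.source = tangentBall p r)
    {u : EuclideanSpace ℝ (Fin n)} (hu : u ∈ tangentBall p r) :
    MDifferentiableAt (𝓡 n) (𝓡 n) Φ u :=
  Φ.mdifferentiableAt (by simp) (by rw [hΦ]; exact hu)

variable [IsManifold (𝓡 n) ∞ M]

lemma normalBall_contDiffAt_chart (hΦ : Φ.source = tangentBall p r)
    {u : EuclideanSpace ℝ (Fin n)} (hu : u ∈ tangentBall p r) (x₀ : M)
    (hx₀ : Φ u ∈ (extChartAt (𝓡 n) x₀).source) :
    ContDiffAt ℝ ∞ (fun x => extChartAt (𝓡 n) x₀ (Φ x)) u := by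
  rw [← contMDiffAt_iff_contDiffAt]
  have h1 : ContMDiffAt (𝓡 n) (𝓡 n) ∞ (extChartAt (𝓡 n) x₀) (Φ u) :=
    contMDiffAt_extChartAt' (by simpa using hx₀)
  exact h1.comp u (Φ.contMDiffOn.contMDiffAt (Φ.open_source.mem_nhds (by rw [hΦ]; exact hu)))

variable [IsContMDiffRiemannianBundle (𝓡 n) ∞ (EuclideanSpace ℝ (Fin n))
      (fun x : M => TangentSpace (𝓡 n) x)]

lemma normalBall_zero (hexp : EqOn Φ (riemannianExp p) (tangentBall p r))
    {v : EuclideanSpace ℝ (Fin n)} (hv : v ∈ tangentBall p r) : Φ 0 = p := by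
  rw [hexp (zero_mem_tangentBall hv), (isExp_zero p).riemannianExp_eq]

variable (hΦ : Φ.source = tangentBall p r) (hexp : EqOn Φ (riemannianExp p) (tangentBall p r))

include hΦ hexp

/-- The rays of a normal ball are geodesics. At vectors where the exponential map is undefined it
has the value `p`, which injectivity excludes. -/
lemma exists_geodesic_ray {v : EuclideanSpace ℝ (Fin n)} (hv : v ∈ tangentBall p r) :
    ∃ γ : ℝ → M, IsGeodesicOn n γ (Icc 0 1) ∧ γ 0 = p ∧
      derivWithin (fun t => extChartAt (𝓡 n) p (γ t)) (Icc 0 1) 0 = v ∧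
      ∀ t ∈ Icc (0 : ℝ) 1, γ t = Φ (t • v) := by
  have hex : ∃ q, IsExp n p v q := by
    by_contra hno
    have h1 : Φ v = p := by
      rw [hexp hv, riemannianExp, dif_neg hno]
    have h0 := zero_mem_tangentBall hv
    have h2 : v = 0 := Φ.injOn (by rw [hΦ]; exact hv) (by rw [hΦ]; exact h0)
      (h1.trans (normalBall_zero hexp hv).symm)
    exact hno ⟨p, by rw [h2]; exact isExp_zero p⟩
  obtain ⟨q, γ, hγ, rfl, hγv, -⟩ := hex
  refine ⟨γ, hγ, rfl, hγv, fun t ht => ?_⟩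
  have h1 := hγ.isExp_smul zero_lt_one ht
  rw [hγv] at h1
  rw [hexp (smul_mem_tangentBall hv ht), h1.riemannianExp_eq]

/-- The differential of the exponential map at the origin is the identity, in the chart at `p`. It
is enough to check this on vectors of the ball, as the ball is absorbing. -/
lemma normalBall_fderiv_zero {v : EuclideanSpace ℝ (Fin n)} (hv : v ∈ tangentBall p r)
    (w : EuclideanSpace ℝ (Fin n)) : fderiv ℝ (fun x => extChartAt (𝓡 n) p (Φ x)) 0 w = w := by
  have h0 := zero_mem_tangentBall hv
  have hp := normalBall_zero hexp hv
  have hd : DifferentiableAt ℝ (fun x => extChartAt (𝓡 n) p (Φ x)) 0 :=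
    (normalBall_contDiffAt_chart hΦ h0 p
      (by rw [hp]; exact mem_extChartAt_source p)).differentiableAt (by simp)
  have key : ∀ v ∈ tangentBall p r, fderiv ℝ (fun x => extChartAt (𝓡 n) p (Φ x)) 0 v = v := by
    intro v hv
    obtain ⟨γ, hγ, hγ0, hγv, hγΦ⟩ := exists_geodesic_ray hΦ hexp hv
    refine Eq.trans (Eq.symm ?_) hγv
    have h1 : HasDerivAt (fun t : ℝ => t • v) v 0 := by
      simpa using (hasDerivAt_id (0 : ℝ)).smul_const v
    have h2 : HasFDerivAt (fun x => extChartAt (𝓡 n) p (Φ x))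
        (fderiv ℝ (fun x => extChartAt (𝓡 n) p (Φ x)) 0) ((0 : ℝ) • v) := by
      simpa using hd.hasFDerivAt
    have h3 := (h2.comp_hasDerivAt (0 : ℝ) h1).hasDerivWithinAt (s := Icc (0 : ℝ) 1)
    refine (h3.congr (fun t ht => ?_) ?_).derivWithin
      (uniqueDiffOn_Icc zero_lt_one 0 ⟨le_rfl, zero_le_one⟩)
    · simp [hγΦ t ht]
    · simp [hγΦ 0 ⟨le_rfl, zero_le_one⟩]
  have hopen : IsOpen (tangentBall p r) := hΦ ▸ Φ.open_source
  have hc : ContinuousAt (fun t : ℝ => t • w) 0 := by fun_prop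
  have hev : ∀ᶠ t : ℝ in 𝓝 0, t • w ∈ tangentBall p r :=
    hc.eventually_mem (hopen.mem_nhds (by simpa using h0))
  obtain ⟨t, ht, htpos⟩ := ((hev.filter_mono nhdsWithin_le_nhds).and
    (self_mem_nhdsWithin (s := Ioi (0 : ℝ)))).exists
  have h1 := key _ ht
  rw [map_smul] at h1
  exact smul_right_injective _ (ne_of_gt htpos) h1

lemma pullMetric_normalBall_zero {v : EuclideanSpace ℝ (Fin n)} (hv : v ∈ tangentBall p r)
    (a b : EuclideanSpace ℝ (Fin n)) : pullMetric Φ 0 a b = fiberInner p a b := by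
  have h0 := zero_mem_tangentBall hv
  have hp := normalBall_zero hexp hv
  have hm : ∀ w : EuclideanSpace ℝ (Fin n), (mfderiv (𝓡 n) (𝓡 n) Φ 0 :
      EuclideanSpace ℝ (Fin n) → EuclideanSpace ℝ (Fin n)) w = w := by
    intro w
    rw [(normalBall_mdifferentiableAt hΦ h0).mfderiv]
    have hw : writtenInExtChartAt (𝓡 n) (𝓡 n) 0 Φ = fun x => extChartAt (𝓡 n) p (Φ x) := by
      rw [← hp]; rfl
    rw [hw, ModelWithCorners.range_eq_univ, fderivWithin_univ]
    exact normalBall_fderiv_zero hΦ hexp hv w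
  have key : ∀ (q : M) (D : EuclideanSpace ℝ (Fin n) → EuclideanSpace ℝ (Fin n)),
      q = p → (∀ w, D w = w) → @inner ℝ (TangentSpace (𝓡 n) q) _ (D a) (D b)
        = @inner ℝ (TangentSpace (𝓡 n) p) _ a b := by
    rintro q D rfl hD; rw [hD, hD]
  exact key (Φ 0) (fun w => mfderiv (𝓡 n) (𝓡 n) Φ 0 w) hp hm

/-- The geodesic equation of the rays, in the coordinates given by the normal ball. -/
lemma radialEulerLagrange_normalBall {v : EuclideanSpace ℝ (Fin n)} (hv : v ∈ tangentBall p r)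
    {t : ℝ} (ht : t ∈ Ioo (0 : ℝ) 1) : RadialEulerLagrange (pullMetric Φ) (t • v) := by
  have htI := Ioo_subset_Icc_self ht
  set u := t • v with hu
  have huB : u ∈ tangentBall p r := smul_mem_tangentBall hv htI
  have hopen : IsOpen (tangentBall p r) := hΦ ▸ Φ.open_source
  set x₀ : M := Φ u with hx₀
  set H : EuclideanSpace ℝ (Fin n) → EuclideanSpace ℝ (Fin n) :=
    fun x => extChartAt (𝓡 n) x₀ (Φ x) with hH
  have hsrc : Φ u ∈ (extChartAt (𝓡 n) x₀).source := mem_extChartAt_source _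
  have htar : H u ∈ (extChartAt (𝓡 n) x₀).target := (extChartAt (𝓡 n) x₀).map_source hsrc
  have hHs : ContDiffAt ℝ 2 H u :=
    (normalBall_contDiffAt_chart hΦ huB x₀ hsrc).of_le ENat.LEInfty.out
  have hpull : ∀ y a b, metricForm x₀ y a b = pullMetric (extChartAt (𝓡 n) x₀).symm y a b :=
    fun y a b => by rw [metricForm_apply, pullMetric_symm_eq_sum]
  refine radialEulerLagrange_of_pullback (H := H) (g := metricForm x₀) hHs
    (differentiableAt_metricForm x₀ htar).1 (fun a b => ?_) (fun a b => ?_) ?_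
  · rw [hpull, hpull, (isBilinSymm_pullMetric _ _).symm]
  · have hc : ContinuousAt Φ u := (normalBall_mdifferentiableAt hΦ huB).continuousAt
    filter_upwards [hc.eventually_mem ((isOpen_extChartAt_source x₀).mem_nhds hsrc),
      hopen.mem_nhds huB] with x hx hxB
    rw [hpull]
    exact pullMetric_eq_chart x₀ (normalBall_mdifferentiableAt hΦ hxB) hx a b
  · apply metricForm_eulerLagrange x₀ htar
    intro k
    obtain ⟨γ, hγ, -, -, hγΦ⟩ := exists_geodesic_ray hΦ hexp hv
    have hline : ∀ τ : ℝ, HasDerivAt (fun τ : ℝ => τ • v) v τ := fun τ => by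
      simpa using (hasDerivAt_id τ).smul_const v
    have hH1 : ∀ᶠ x in 𝓝 u, DifferentiableAt ℝ H x :=
      (hHs.eventually (by simp)).mono fun x hx => hx.differentiableAt (by norm_num)
    have hcont : ContinuousAt (fun τ : ℝ => τ • v) t := by fun_prop
    have hev : ∀ᶠ τ in 𝓝 t, DifferentiableAt ℝ H (τ • v) := hcont.eventually hH1
    have hI : Icc (0 : ℝ) 1 ∈ 𝓝 t := Icc_mem_nhds ht.1 ht.2
    have e1 : (fun τ => extChartAt (𝓡 n) x₀ (γ τ)) =ᶠ[𝓝 t] fun τ => H (τ • v) := by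
      filter_upwards [hI] with τ hτ
      simp only [hH, hγΦ τ hτ]
    have e2 : derivWithin (fun τ => extChartAt (𝓡 n) x₀ (γ τ)) (Icc 0 1)
        =ᶠ[𝓝 t] fun τ => fderiv ℝ H (τ • v) v := by
      filter_upwards [e1.eventuallyEq_nhds, hev, Ioo_mem_nhds ht.1 ht.2] with τ hτ hτd hτI
      rw [derivWithin_of_mem_nhds (Icc_mem_nhds hτI.1 hτI.2), hτ.deriv_eq]
      exact (HasFDerivAt.comp_hasDerivAt τ hτd.hasFDerivAt (hline τ)).deriv
    have hD2 : HasDerivAt (fun τ => fderiv ℝ H (τ • v) v) (fderiv ℝ (fderiv ℝ H) u v v) t := by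
      have h1 : HasFDerivAt (fderiv ℝ H) (fderiv ℝ (fderiv ℝ H) u) (t • v) :=
        ((hHs.fderiv_right (m := 1) (by norm_num)).differentiableAt (by norm_num)).hasFDerivAt
      have h2 := h1.comp_hasDerivAt t (hline t)
      simpa using h2.clm_apply (hasDerivAt_const t v)
    have hsrc' : γ t ∈ (extChartAt (𝓡 n) x₀).source := by rw [hγΦ t htI]; exact hsrc
    have hgeo := hγ.hasDerivWithinAt (uniqueDiffOn_Icc zero_lt_one) x₀ htI hsrc'
    have hgeo2 := (ContinuousLinearMap.snd ℝ (EuclideanSpace ℝ (Fin n))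
      (EuclideanSpace ℝ (Fin n))).hasFDerivAt.comp_hasDerivAt t (hgeo.hasDerivAt hI)
    have hacc := HasDerivAt.unique hgeo2 (hD2.congr_of_eventuallyEq e2)
    rw [e2.eq_of_nhds] at hacc
    have hpos : extChartAt (𝓡 n) x₀ (γ t) = H u := e1.eq_of_nhds
    rw [hpos] at hacc
    change -christoffelQuad x₀ (H u) (fderiv ℝ H (t • v) v) = _ at hacc
    have hk := congrArg (fun z : EuclideanSpace ℝ (Fin n) => z k) hacc
    simp only [christoffelQuad, PiLp.neg_apply] at hk
    have hx' : fderiv ℝ H u u = t • fderiv ℝ H u v := by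
      conv_lhs => rw [hu, map_smul]
    have hx'' : fderiv ℝ (fderiv ℝ H) u u u = t ^ 2 • fderiv ℝ (fderiv ℝ H) u v v := by
      have : ∀ L : EuclideanSpace ℝ (Fin n) →L[ℝ]
          EuclideanSpace ℝ (Fin n) →L[ℝ] EuclideanSpace ℝ (Fin n),
          L (t • v) (t • v) = t ^ 2 • L v v := fun L => by
        rw [map_smul, map_smul, smul_apply, smul_smul, sq]
      exact this _
    rw [hx', hx'']
    simp only [PiLp.smul_apply, smul_eq_mul, ← hk]
    rw [mul_neg, Finset.mul_sum, neg_add_eq_zero]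
    refine Finset.sum_congr rfl fun i _ => ?_
    rw [Finset.mul_sum]
    refine Finset.sum_congr rfl fun j _ => ?_
    rw [← hu]
    ring

/-- The **Gauss lemma** in a normal ball. -/
theorem pullMetric_normalBall {u : EuclideanSpace ℝ (Fin n)} (hu : u ∈ tangentBall p r)
    (w : EuclideanSpace ℝ (Fin n)) : pullMetric Φ u u w = fiberInner p u w := by
  have hopen : IsOpen (tangentBall p r) := hΦ ▸ Φ.open_source
  rw [gauss_lemma hopen (fun u hu t ht => smul_mem_tangentBall hu ht) (fun a b => ?_)
    (fun u _ => isBilinSymm_pullMetric Φ u)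
    (fun v hv t ht => radialEulerLagrange_normalBall hΦ hexp hv ht) hu,
    pullMetric_normalBall_zero hΦ hexp hu]
  exact (contDiffOn_pullMetric hopen (hΦ ▸ Φ.contMDiffOn) a b).differentiableOn (by simp)

end NormalBall

/-! ### Radial geodesics are shortest paths -/

section Distance

variable {n : ℕ}

lemma IsBilinSymm.contDiff_self {B : EuclideanSpace ℝ (Fin n) → EuclideanSpace ℝ (Fin n) → ℝ}
    (h : IsBilinSymm B) : ContDiff ℝ ∞ (fun a => B a a) := by
  have h1 : (fun a => B a a) = fun a : EuclideanSpace ℝ (Fin n) => ∑ i, ∑ j,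
      B (EuclideanSpace.single i 1) (EuclideanSpace.single j 1) * a i * a j := by
    funext a; exact h.eq_sum a a
  rw [h1]
  fun_prop

lemma IsBilinSymm.fderiv_self {B : EuclideanSpace ℝ (Fin n) → EuclideanSpace ℝ (Fin n) → ℝ}
    (h : IsBilinSymm B) (a w : EuclideanSpace ℝ (Fin n)) :
    fderiv ℝ (fun a => B a a) a w = 2 * B a w := by
  have hline : HasDerivAt (fun r : ℝ => a + r • w) w 0 := by
    simpa using ((hasDerivAt_id (0 : ℝ)).smul_const w).const_add a
  have h1 : HasFDerivAt (fun a => B a a) (fderiv ℝ (fun a => B a a) a) (a + (0 : ℝ) • w) := by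
    simpa using (h.contDiff_self.differentiable (by simp) a).hasFDerivAt
  have h2 := h1.comp_hasDerivAt (0 : ℝ) hline
  have h3 : HasDerivAt (fun r : ℝ => B a a + (2 * r) * B a w + r ^ 2 * B w w) (2 * B a w) 0 := by
    have := ((hasDerivAt_const (0 : ℝ) (B a a)).add
      (((hasDerivAt_id (0 : ℝ)).const_mul 2).mul (hasDerivAt_const (0 : ℝ) (B a w)))).add
      (((hasDerivAt_id (0 : ℝ)).pow 2).mul (hasDerivAt_const (0 : ℝ) (B w w)))
    exact this.congr_deriv (by simp)
  refine HasDerivAt.unique h2 (h3.congr_of_eventuallyEq (Eventually.of_forall fun r => ?_))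
  simp only [Function.comp]
  rw [h.add_left, h.add_right, h.add_right, h.smul_left, h.smul_left, h.smul_right,
    h.smul_right, h.symm w a]
  ring

variable {M : Type*} [MetricSpace M] [ChartedSpace (EuclideanSpace ℝ (Fin n)) M]
variable [Bundle.RiemannianBundle (fun x : M => TangentSpace (𝓡 n) x)]

/-- The norm of the tangent space at `p`, for vectors of the coordinate space. -/
noncomputable def fiberNorm (p : M) (a : EuclideanSpace ℝ (Fin n)) : ℝ :=
  @norm (TangentSpace (𝓡 n) p) _ a

lemma fiberInner_self (p : M) (a : EuclideanSpace ℝ (Fin n)) :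
    fiberInner p a a = fiberNorm p a ^ 2 :=
  real_inner_self_eq_norm_sq (F := TangentSpace (𝓡 n) p) a

lemma fiberNorm_nonneg (p : M) (a : EuclideanSpace ℝ (Fin n)) : 0 ≤ fiberNorm p a :=
  norm_nonneg (E := TangentSpace (𝓡 n) p) a

lemma mem_tangentBall_iff {p : M} {r : ℝ≥0∞} {a : EuclideanSpace ℝ (Fin n)} :
    a ∈ tangentBall p r ↔ ENNReal.ofReal (fiberNorm p a) < r := by
  have h : ENNReal.ofReal (fiberNorm p a) = @enorm (TangentSpace (𝓡 n) p) _ a :=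
    ofReal_norm (E := TangentSpace (𝓡 n) p) a
  rw [h]
  rfl

lemma isCompact_fiberNorm_le (p : M) (L : ℝ) :
    IsCompact {a : EuclideanSpace ℝ (Fin n) | fiberNorm p a ≤ L} := by
  have : FiniteDimensional ℝ (TangentSpace (𝓡 n) p) :=
    inferInstanceAs (FiniteDimensional ℝ (EuclideanSpace ℝ (Fin n)))
  have : ProperSpace (TangentSpace (𝓡 n) p) := FiniteDimensional.proper ℝ _
  have h := isCompact_closedBall (0 : TangentSpace (𝓡 n) p) L
  have h2 : Metric.closedBall (0 : TangentSpace (𝓡 n) p) L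
      = {a : TangentSpace (𝓡 n) p | fiberNorm p a ≤ L} := by
    ext a; exact mem_closedBall_zero_iff
  rw [h2] at h
  exact h

variable [IsManifold (𝓡 n) ∞ M]
  [IsContMDiffRiemannianBundle (𝓡 n) ∞ (EuclideanSpace ℝ (Fin n))
      (fun x : M => TangentSpace (𝓡 n) x)]
  {p : M} {r : ℝ≥0∞} {Φ : PartialDiffeomorph (𝓡 n) (𝓡 n) (EuclideanSpace ℝ (Fin n)) M ∞}
  (hΦ : Φ.source = tangentBall p r) (hexp : EqOn Φ (riemannianExp p) (tangentBall p r))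

include hΦ hexp

/-- A path that starts at the centre of a normal ball and stays in it is at least as long as the
radial coordinate of its end point. The radial function, which is singular at the centre, is
replaced by `√(ε² + |u|²)`, whose gradient has norm at most `1` by the Gauss lemma. -/
lemma fiberNorm_le_pathELength (hr : 0 < r) {γ : ℝ → M} {T : ℝ} (hT : 0 < T)
    (hγ : ContMDiffOn 𝓘(ℝ, ℝ) (𝓡 n) 1 γ (Icc 0 T)) (h0 : γ 0 = p)
    (hmaps : MapsTo γ (Icc 0 T) Φ.target) :
    ENNReal.ofReal (fiberNorm p (Φ.symm (γ T))) ≤ Manifold.pathELength (𝓡 n) γ 0 T := by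
  have hzero : (0 : EuclideanSpace ℝ (Fin n)) ∈ tangentBall p r :=
    mem_tangentBall_iff.2 (by
      have : fiberNorm p (0 : EuclideanSpace ℝ (Fin n)) = 0 := norm_zero (E := TangentSpace (𝓡 n) p)
      simpa [this] using hr)
  have hp := normalBall_zero hexp hzero
  have hu : UniqueDiffOn ℝ (Icc 0 T) := uniqueDiffOn_Icc hT
  set c : ℝ → EuclideanSpace ℝ (Fin n) := fun t => Φ.symm (γ t) with hc
  have hcB : ∀ t ∈ Icc 0 T, c t ∈ tangentBall p r := fun t ht => by
    rw [← hΦ]; exact Φ.map_target (hmaps ht)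
  have hΦc : ∀ t ∈ Icc 0 T, Φ (c t) = γ t := fun t ht => Φ.right_inv (hmaps ht)
  have hc0 : c 0 = 0 := by
    have h1 : Φ.symm (Φ 0) = 0 := Φ.left_inv (by rw [hΦ]; exact hzero)
    simp only [hc]
    rw [h0, ← hp]; exact h1
  have hcs : ContDiffOn ℝ 1 c (Icc 0 T) := by
    rw [← contMDiffOn_iff_contDiffOn]
    have h1 : ContMDiffOn (𝓡 n) (𝓡 n) 1 Φ.symm Φ.target :=
      Φ.contMDiffOn_invFun.of_le ENat.LEInfty.out
    exact h1.comp hγ hmaps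
  have hcd : ∀ t ∈ Icc 0 T, HasDerivWithinAt c (derivWithin c (Icc 0 T) t) (Icc 0 T) t :=
    fun t ht => ((hcs.differentiableOn (by norm_num)) t ht).hasDerivWithinAt
  -- the speed of the path, in the coordinates of the normal ball
  have hspeed : ∀ t ∈ Icc 0 T, ‖mfderivWithin 𝓘(ℝ, ℝ) (𝓡 n) γ (Icc 0 T) t (1 : ℝ)‖
      = ‖mfderiv (𝓡 n) (𝓡 n) Φ (c t) (derivWithin c (Icc 0 T) t)‖ := by
    intro t ht
    have h1 : mfderivWithin 𝓘(ℝ, ℝ) (𝓡 n) (Φ ∘ c) (Icc 0 T) t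
        = (mfderiv (𝓡 n) (𝓡 n) Φ (c t)).comp (mfderivWithin 𝓘(ℝ, ℝ) (𝓡 n) c (Icc 0 T) t) :=
      mfderiv_comp_mfderivWithin t (normalBall_mdifferentiableAt hΦ (hcB t ht))
        (hcd t ht).differentiableWithinAt.mdifferentiableWithinAt
        (hu t ht).uniqueMDiffWithinAt
    have h2 : mfderivWithin 𝓘(ℝ, ℝ) (𝓡 n) c (Icc 0 T) t (1 : ℝ) = derivWithin c (Icc 0 T) t := by
      rw [mfderivWithin_eq_fderivWithin, ← fderivWithin_derivWithin]
      rfl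
    have h3 : mfderivWithin 𝓘(ℝ, ℝ) (𝓡 n) γ (Icc 0 T) t
        = (mfderivWithin 𝓘(ℝ, ℝ) (𝓡 n) (Φ ∘ c) (Icc 0 T) t : ℝ →L[ℝ] EuclideanSpace ℝ (Fin n)) :=
      mfderivWithin_congr (fun s hs => (hΦc s hs).symm) (hΦc t ht).symm
    have key : ∀ (q q' : M) (D D' : EuclideanSpace ℝ (Fin n)), q = q' → D = D' →
        @norm (TangentSpace (𝓡 n) q) _ D = @norm (TangentSpace (𝓡 n) q') _ D' := by
      rintro q _ D _ rfl rfl; rfl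
    refine key _ _ _ _ (hΦc t ht).symm ?_
    have h4 := congrArg (fun L : ℝ →L[ℝ] EuclideanSpace ℝ (Fin n) => L 1) (h3.trans h1)
    refine h4.trans ?_
    exact congrArg (mfderiv (𝓡 n) (𝓡 n) Φ (c t)) h2
  have hB := isBilinSymm_fiberInner (n := n) p
  refine ENNReal.le_of_forall_pos_le_add fun ε hε _ => ?_
  have hε' : (0 : ℝ) < ε := hε
  have hposq : ∀ u : EuclideanSpace ℝ (Fin n), 0 < (ε : ℝ) ^ 2 + fiberInner p u u := fun u => by
    rw [fiberInner_self]; positivity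
  set f : ℝ → ℝ := fun t => √((ε : ℝ) ^ 2 + fiberInner p (c t) (c t)) with hf
  have hfs : ContDiffOn ℝ 1 f (Icc 0 T) := by
    have h1 : ContDiffOn ℝ 1 (fun t => fiberInner p (c t) (c t)) (Icc 0 T) :=
      (hB.contDiff_self.of_le ENat.LEInfty.out).comp_contDiffOn hcs
    exact (contDiffOn_const.add h1).sqrt fun t _ => (hposq _).ne'
  have hfd : ∀ t ∈ Icc 0 T, ‖derivWithin f (Icc 0 T) t‖ₑ
      ≤ ‖mfderivWithin 𝓘(ℝ, ℝ) (𝓡 n) γ (Icc 0 T) t (1 : ℝ)‖ₑ := by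
    intro t ht
    have h1 : HasDerivWithinAt (fun t => fiberInner p (c t) (c t))
        (2 * fiberInner p (c t) (derivWithin c (Icc 0 T) t)) (Icc 0 T) t := by
      have := (hB.contDiff_self.differentiable (by simp) (c t)).hasFDerivAt.comp_hasDerivWithinAt t
        (hcd t ht)
      rwa [hB.fderiv_self] at this
    have h2 := ((h1.const_add ((ε : ℝ) ^ 2)).sqrt (hposq _).ne').derivWithin (hu t ht)
    have h3 : |fiberInner p (c t) (derivWithin c (Icc 0 T) t)| ≤ fiberNorm p (c t) *
        ‖mfderivWithin 𝓘(ℝ, ℝ) (𝓡 n) γ (Icc 0 T) t (1 : ℝ)‖ := by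
      rw [hspeed t ht, ← pullMetric_normalBall hΦ hexp (hcB t ht)]
      refine (abs_pullMetric_le _ _ _ _).trans_eq ?_
      congr 1
      have h4 := pullMetric_normalBall hΦ hexp (hcB t ht) (c t)
      rw [pullMetric_self, fiberInner_self] at h4
      exact (sq_eq_sq₀ (norm_nonneg _) (fiberNorm_nonneg _ _)).1 h4
    rw [← ofReal_norm, ← ofReal_norm]
    refine ENNReal.ofReal_le_ofReal ?_
    rw [h2, Real.norm_eq_abs, mul_div_mul_left _ _ two_ne_zero, abs_div,
      abs_of_nonneg (Real.sqrt_nonneg _), div_le_iff₀ (Real.sqrt_pos.2 (hposq _)), mul_comm]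
    refine h3.trans (mul_le_mul_of_nonneg_right ?_ (norm_nonneg _))
    refine Real.le_sqrt_of_sq_le ?_
    rw [fiberInner_self]
    nlinarith
  have hlen : ‖f T - f 0‖ₑ ≤ Manifold.pathELength (𝓡 n) γ 0 T := by
    refine (enorm_sub_le_lintegral_derivWithin_Icc_of_contDiffOn_Icc hfs hT.le).trans ?_
    rw [Manifold.pathELength_eq_lintegral_mfderivWithin_Icc]
    exact setLIntegral_mono' measurableSet_Icc hfd
  have hf0 : f 0 = ε := by
    simp only [hf, hc0, hB.zero_left, add_zero]
    exact Real.sqrt_sq hε'.le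
  have hfT : fiberNorm p (c T) ≤ f T := by
    refine Real.le_sqrt_of_sq_le ?_
    rw [fiberInner_self]
    nlinarith
  calc ENNReal.ofReal (fiberNorm p (c T)) ≤ ENNReal.ofReal (‖f T - f 0‖ + ε) := by
        refine ENNReal.ofReal_le_ofReal ?_
        rw [hf0, Real.norm_eq_abs]
        linarith [le_abs_self (f T - ε)]
    _ ≤ ENNReal.ofReal ‖f T - f 0‖ + ENNReal.ofReal ε := ENNReal.ofReal_add_le
    _ ≤ _ := by
        rw [ofReal_norm, ENNReal.ofReal_coe_nnreal]
        gcongr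

/-- In a normal ball the radial geodesics are shortest paths. A path that leaves the ball is cut
off at the time of exit: up to that time the radial coordinate stays below the length of the
path. -/
theorem fiberNorm_le_riemannianEDist {u : EuclideanSpace ℝ (Fin n)} (hu : u ∈ tangentBall p r) :
    ENNReal.ofReal (fiberNorm p u) ≤ Manifold.riemannianEDist (𝓡 n) p (Φ u) := by
  by_contra! hlt
  obtain ⟨γ, hγ0, hγ1, hγ, hlen⟩ := Manifold.exists_lt_of_riemannianEDist_lt hlt
  have hr : 0 < r := zero_le.trans_lt (mem_tangentBall_iff.1 hu)
  have hp := normalBall_zero hexp hu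
  have hzero := zero_mem_tangentBall hu
  set L := (Manifold.pathELength (𝓡 n) γ 0 1).toReal with hL
  -- `L < |u|_p < r`, so that the closed ball of radius `L` is compact in the normal ball
  have hLtop : Manifold.pathELength (𝓡 n) γ 0 1 ≠ ⊤ := (hlen.trans_le le_top).ne
  have hLr : ENNReal.ofReal L < r := by
    rw [hL, ENNReal.ofReal_toReal hLtop]
    exact hlen.trans (mem_tangentBall_iff.1 hu)
  have hest : ∀ T ∈ Icc (0 : ℝ) 1, MapsTo γ (Icc 0 T) Φ.target →
      fiberNorm p (Φ.symm (γ T)) ≤ L := by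
    intro T hT hmaps
    rcases hT.1.eq_or_lt with rfl | hpos
    · have h1 : Φ.symm (Φ 0) = 0 := Φ.left_inv (by rw [hΦ]; exact hzero)
      rw [hγ0, ← hp, h1]
      have : fiberNorm (Φ 0) (0 : EuclideanSpace ℝ (Fin n)) = 0 :=
        norm_zero (E := TangentSpace (𝓡 n) (Φ 0))
      rw [this]; exact ENNReal.toReal_nonneg
    · have h1 := fiberNorm_le_pathELength hΦ hexp hr hpos
        (hγ.mono (Icc_subset_Icc_right hT.2)) hγ0 hmaps
      have h2 := h1.trans (Manifold.pathELength_mono le_rfl hT.2)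
      exact (ENNReal.ofReal_le_iff_le_toReal hLtop).1 h2
  have hcont : ContinuousOn γ (Icc 0 1) := hγ.continuousOn
  set K : Set M := Φ '' {a | fiberNorm p a ≤ L} with hK
  have hKsub : {a : EuclideanSpace ℝ (Fin n) | fiberNorm p a ≤ L} ⊆ Φ.source := fun a ha => by
    rw [hΦ]
    exact mem_tangentBall_iff.2 ((ENNReal.ofReal_le_ofReal ha).trans_lt hLr)
  have hKc : IsClosed K :=
    ((isCompact_fiberNorm_le p L).image_of_continuousOn
      (Φ.contMDiffOn.continuousOn.mono hKsub)).isClosed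
  have hall : MapsTo γ (Icc 0 1) Φ.target := by
    by_contra hnot
    -- the first time at which the path is outside of the normal ball
    have hA : IsCompact (Icc (0 : ℝ) 1 ∩ γ ⁻¹' Φ.targetᶜ) :=
      isCompact_Icc.of_isClosed_subset
        (hcont.preimage_isClosed_of_isClosed isClosed_Icc Φ.open_target.isClosed_compl)
        inter_subset_left
    have hne : (Icc (0 : ℝ) 1 ∩ γ ⁻¹' Φ.targetᶜ).Nonempty := by
      simp only [MapsTo, not_forall] at hnot
      obtain ⟨t, ht, h⟩ := hnot
      exact ⟨t, ht, h⟩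
    obtain ⟨T, ⟨hTI, hTn⟩, hmin⟩ := hA.exists_isLeast hne
    have hTpos : 0 < T := by
      refine hTI.1.lt_of_ne fun h => hTn ?_
      rw [← h, hγ0, ← hp]
      exact Φ.map_source (by rw [hΦ]; exact hzero)
    have hin : ∀ t ∈ Ico 0 T, γ t ∈ K := by
      intro t ht
      have hmaps : MapsTo γ (Icc 0 t) Φ.target := by
        intro s hs
        by_contra h
        exact absurd (hmin ⟨⟨hs.1, hs.2.trans (ht.2.le.trans hTI.2)⟩, h⟩) (by linarith [hs.2, ht.2])
      exact ⟨Φ.symm (γ t), hest t ⟨ht.1, ht.2.le.trans hTI.2⟩ hmaps,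
        Φ.right_inv (hmaps ⟨ht.1, le_rfl⟩)⟩
    have hTK : γ T ∈ K := by
      have hclT : T ∈ closure (Ico 0 T) := by
        rw [closure_Ico hTpos.ne]; exact ⟨hTpos.le, le_rfl⟩
      have hcw : ContinuousWithinAt γ (Ico 0 T) T :=
        (hcont T hTI).mono fun t ht => ⟨ht.1, ht.2.le.trans hTI.2⟩
      exact hKc.closure_subset (hcw.mem_closure hclT hin)
    obtain ⟨a, ha, haT⟩ := hTK
    exact hTn (by rw [← haT]; exact Φ.map_source (hKsub ha))
  have h1 := fiberNorm_le_pathELength hΦ hexp hr zero_lt_one hγ hγ0 hall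
  have h2 : Φ.symm (γ 1) = u := by
    rw [hγ1]; exact Φ.left_inv (by rw [hΦ]; exact hu)
  rw [h2] at h1
  exact absurd hlen (not_lt.2 h1)

end Distance

/-! ### Geodesic loops -/

section Loop

variable {n : ℕ} {M : Type*} [MetricSpace M] [ChartedSpace (EuclideanSpace ℝ (Fin n)) M]
variable [Bundle.RiemannianBundle (fun x : M => TangentSpace (𝓡 n) x)]

/-- The speed of a curve, computed in the chart at the point. -/
lemma norm_mfderivWithin_eq_fiberNorm {γ : ℝ → M} {s : Set ℝ} {t : ℝ}
    (h : MDifferentiableWithinAt 𝓘(ℝ, ℝ) (𝓡 n) γ s t) :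
    ‖mfderivWithin 𝓘(ℝ, ℝ) (𝓡 n) γ s t (1 : ℝ)‖
      = fiberNorm (γ t) (derivWithin (fun r => extChartAt (𝓡 n) (γ t) (γ r)) s t) := by
  rw [h.mfderivWithin, ← fderivWithin_derivWithin]
  simp only [writtenInExtChartAt, extChartAt_model_space_eq_id, PartialEquiv.refl_symm,
    PartialEquiv.refl_coe, Function.comp_id, preimage_id, ModelWithCorners.range_eq_univ,
    inter_univ,
    id]
  rfl

lemma fiberNorm_smul (p : M) (t : ℝ) (v : EuclideanSpace ℝ (Fin n)) :
    fiberNorm p (t • v) = |t| * fiberNorm p v :=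
  norm_smul (β := TangentSpace (𝓡 n) p) t v

variable [IsManifold (𝓡 n) ∞ M]
  [IsContMDiffRiemannianBundle (𝓡 n) ∞ (EuclideanSpace ℝ (Fin n))
      (fun x : M => TangentSpace (𝓡 n) x)]
  [IsRiemannianManifold (𝓡 n) M]

omit [IsManifold (𝓡 n) ∞ M] [IsContMDiffRiemannianBundle (𝓡 n) ∞ (EuclideanSpace ℝ (Fin n))
      (fun x : M => TangentSpace (𝓡 n) x)] in
/-- A curve of unit speed does not increase distances. -/
lemma edist_le_of_unit_speed {γ : ℝ → M} {l a b : ℝ}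
    (hγ : ContMDiffOn 𝓘(ℝ, ℝ) (𝓡 n) ∞ γ (Icc 0 l))
    (hspeed : ∀ t ∈ Icc 0 l, ‖mfderivWithin 𝓘(ℝ, ℝ) (𝓡 n) γ (Icc 0 l) t (1 : ℝ)‖ = 1)
    (ha : 0 ≤ a) (hab : a ≤ b) (hb : b ≤ l) : edist (γ a) (γ b) ≤ ENNReal.ofReal (b - a) := by
  have hsub : Icc a b ⊆ Icc 0 l := Icc_subset_Icc ha hb
  rw [IsRiemannianManifold.out (I := 𝓡 n) (γ a) (γ b)]
  refine (Manifold.riemannianEDist_le_pathELength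
    ((hγ.mono hsub).of_le ENat.LEInfty.out) rfl rfl hab).trans ?_
  rw [Manifold.pathELength_eq_lintegral_mfderiv_Ioo]
  have h1 : ∀ t ∈ Ioo a b, ‖mfderiv 𝓘(ℝ, ℝ) (𝓡 n) γ t (1 : ℝ)‖ₑ ≤ 1 := by
    intro t ht
    have hI : Icc 0 l ∈ 𝓝 t := Icc_mem_nhds (ha.trans_lt ht.1) (ht.2.trans_le hb)
    have h2 := hspeed t (hsub (Ioo_subset_Icc_self ht))
    rw [mfderivWithin_of_mem_nhds hI] at h2
    rw [← ofReal_norm, h2, ENNReal.ofReal_one]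
  refine (setLIntegral_mono' measurableSet_Ioo h1).trans ?_
  rw [setLIntegral_one, Real.volume_Ioo]

/-- Up to the injectivity radius, a geodesic of unit speed is as long as the distance between its
end points. -/
lemma le_edist_of_lt_injRadius {γ : ℝ → M} {l t : ℝ} (hl : 0 < l)
    (hγ : IsGeodesicOn n γ (Icc 0 l))
    (hspeed : fiberNorm (γ 0) (derivWithin (fun r => extChartAt (𝓡 n) (γ 0) (γ r)) (Icc 0 l) 0) = 1)
    (ht : t ∈ Icc 0 l) (hinj : ENNReal.ofReal t < injRadius n (γ 0)) :
    ENNReal.ofReal t ≤ edist (γ 0) (γ t) := by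
  obtain ⟨r, ⟨Φ, hΦ, hexp⟩, htr⟩ := lt_sSup_iff.1 hinj
  have h1 := hγ.isExp_smul hl ht
  set v := derivWithin (fun r => extChartAt (𝓡 n) (γ 0) (γ r)) (Icc 0 l) 0
  have hn : fiberNorm (γ 0) (t • v) = t := by
    rw [fiberNorm_smul, hspeed, mul_one, abs_of_nonneg ht.1]
  have hmem : t • v ∈ tangentBall (γ 0) r := mem_tangentBall_iff.2 (by rwa [hn])
  have h2 := fiberNorm_le_riemannianEDist hΦ hexp hmem
  rw [hn, hexp hmem, h1.riemannianExp_eq, ← IsRiemannianManifold.out (I := 𝓡 n)] at h2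
  exact h2

omit [IsContMDiffRiemannianBundle (𝓡 n) ∞ (EuclideanSpace ℝ (Fin n))
      (fun x : M => TangentSpace (𝓡 n) x)] [IsRiemannianManifold (𝓡 n) M] in
/-- The reverse of a geodesic loop is a geodesic that leaves `p` with unit speed. -/
lemma IsGeodesicLoop.reverse {σ : ℝ → M} {p : M} {l : ℝ} (h : IsGeodesicLoop n σ p l) :
    IsGeodesicOn n (fun r => σ (-1 * r + l)) (Icc 0 l) ∧
      fiberNorm p (derivWithin (fun r => extChartAt (𝓡 n) p (σ (-1 * r + l))) (Icc 0 l) 0) = 1 := by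
  obtain ⟨hl, hγ, hspeed, h0, h1⟩ := h
  have hu : UniqueDiffOn ℝ (Icc 0 l) := uniqueDiffOn_Icc hl
  have hmaps : MapsTo (fun r => -1 * r + l) (Icc 0 l) (Icc 0 l) := fun r hr =>
    ⟨by linarith [hr.2], by linarith [hr.1]⟩
  have hlI : l ∈ Icc 0 l := ⟨hl.le, le_rfl⟩
  refine ⟨hγ.comp_affine hu hu hmaps, ?_⟩
  have hd := (contDiffWithinAt_chart p (hγ.1 l hlI)
    (by rw [h1]; exact mem_extChartAt_source _)).differentiableWithinAt (by simp)
  rw [derivWithin_comp_affine (f := fun r => extChartAt (𝓡 n) p (σ r)) (t := 0) hu hmaps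
    ⟨le_rfl, hl.le⟩ (by simpa using hd), fiberNorm_smul]
  have h2 := hspeed l hlI
  rw [norm_mfderivWithin_eq_fiberNorm ((hγ.1 l hlI).mdifferentiableWithinAt (by simp)), h1] at h2
  simpa using h2

/-- On its first half a geodesic loop of length `2 inj(p)` is a shortest path. -/
lemma IsGeodesicLoop.dist_eq_left {σ : ℝ → M} {p : M}
    (h : IsGeodesicLoop n σ p (2 * (injRadius n p).toReal)) {s : ℝ}
    (hs : s ∈ Ico 0 (injRadius n p).toReal) : dist p (σ s) = s := by
  obtain ⟨hl, hγ, hspeed, h0, h1⟩ := h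
  have hsI : s ∈ Icc 0 (2 * (injRadius n p).toReal) := ⟨hs.1, by linarith [hs.1, hs.2]⟩
  have hinj : ENNReal.ofReal s < injRadius n p := by
    rw [ENNReal.ofReal_lt_iff_lt_toReal hs.1]
    · exact hs.2
    · -- an infinite radius would have the real value `0`, and the loop has positive length
      intro htop; rw [htop] at hl; simp at hl
  have h2 := hspeed 0 ⟨le_rfl, hl.le⟩
  rw [norm_mfderivWithin_eq_fiberNorm
    ((hγ.1 0 ⟨le_rfl, hl.le⟩).mdifferentiableWithinAt (by simp))] at h2
  have hlow := le_edist_of_lt_injRadius hl hγ h2 hsI (by rwa [h0])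
  have hup := edist_le_of_unit_speed hγ.1 hspeed le_rfl hs.1 hsI.2
  rw [h0, edist_dist] at hlow hup
  rw [sub_zero] at hup
  exact le_antisymm ((ENNReal.ofReal_le_ofReal_iff hs.1).1 hup)
    ((ENNReal.ofReal_le_ofReal_iff dist_nonneg).1 hlow)

/-- On its second half a geodesic loop of length `2 inj(p)` is a shortest path. -/
lemma IsGeodesicLoop.dist_eq_right {σ : ℝ → M} {p : M}
    (h : IsGeodesicLoop n σ p (2 * (injRadius n p).toReal)) {s : ℝ}
    (hs : s ∈ Ioc (injRadius n p).toReal (2 * (injRadius n p).toReal)) :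
    dist p (σ s) = 2 * (injRadius n p).toReal - s := by
  obtain ⟨hγ', hspeed'⟩ := h.reverse
  obtain ⟨hl, hγ, hspeed, h0, h1⟩ := h
  set l := 2 * (injRadius n p).toReal with hldef
  have hs' : 0 ≤ l - s := by linarith [hs.2]
  have hsI : l - s ∈ Icc 0 l := ⟨hs', by linarith [hs.1]⟩
  have hinj : ENNReal.ofReal (l - s) < injRadius n p := by
    rw [ENNReal.ofReal_lt_iff_lt_toReal hs']
    · linarith [hs.1]
    · intro htop; rw [hldef, htop] at hl; simp at hl
  have hstart : σ (-1 * 0 + l) = p := by simpa using h1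
  have hlow := le_edist_of_lt_injRadius hl hγ' (by rw [hstart]; exact hspeed') hsI
    (by rwa [hstart])
  have hup := edist_le_of_unit_speed hγ.1 hspeed (by linarith [hs.1]) hs.2 le_rfl
  rw [hstart, show -1 * (l - s) + l = s by ring, edist_dist] at hlow
  rw [h1, edist_dist, dist_comm] at hup
  exact le_antisymm ((ENNReal.ofReal_le_ofReal_iff hs').1 hup)
    ((ENNReal.ofReal_le_ofReal_iff dist_nonneg).1 hlow)

/-- The set of times at which a geodesic loop of length `2 inj(p)` is `ε`-close to a given point has
measure at most `4 ε`, as each of the halves contributes at most `2 ε`. -/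
lemma IsGeodesicLoop.volume_close_le {σ : ℝ → M} {p : M}
    (h : IsGeodesicLoop n σ p (2 * (injRadius n p).toReal)) (z : M) {ε : ℝ} (hε : 0 < ε) :
    volume {s | s ∈ Icc 0 (2 * (injRadius n p).toReal) ∧ dist z (σ s) < ε}
      ≤ ENNReal.ofReal (4 * ε) := by
  set I := (injRadius n p).toReal
  set A : Set ℝ := {s | s ∈ Icc 0 (2 * I) ∧ dist z (σ s) < ε} with hA
  have key : ∀ J : Set ℝ, (∀ s ∈ J, ∀ t ∈ J, |s - t| ≤ |dist p (σ s) - dist p (σ t)|) →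
      volume (A ∩ J) ≤ ENNReal.ofReal (2 * ε) := by
    intro J hJ
    refine (Real.volume_le_diam _).trans (Metric.ediam_le fun s hs t ht => ?_)
    rw [edist_dist]
    refine ENNReal.ofReal_le_ofReal ?_
    rw [Real.dist_eq]
    have h1 := abs_dist_sub_le (σ s) (σ t) p
    rw [dist_comm (σ s) p, dist_comm (σ t) p] at h1
    have h2 := dist_triangle_left (σ s) (σ t) z
    linarith [hJ s hs.2 t ht.2, hs.1.2, ht.1.2]
  have hsub : A ⊆ (A ∩ Ico 0 I) ∪ (A ∩ Ioc I (2 * I)) ∪ {I} := by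
    intro s hs
    rcases lt_trichotomy s I with hlt | heq | hgt
    · exact Or.inl (Or.inl ⟨hs, hs.1.1, hlt⟩)
    · exact Or.inr heq
    · exact Or.inl (Or.inr ⟨hs, hgt, hs.1.2⟩)
  calc volume A ≤ volume ((A ∩ Ico 0 I) ∪ (A ∩ Ioc I (2 * I)) ∪ {I}) := measure_mono hsub
    _ ≤ volume (A ∩ Ico 0 I) + volume (A ∩ Ioc I (2 * I)) + volume {I} :=
        (measure_union_le _ _).trans (by gcongr; exact measure_union_le _ _)
    _ ≤ ENNReal.ofReal (2 * ε) + ENNReal.ofReal (2 * ε) + 0 := by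
        gcongr
        · refine key _ fun s hs t ht => ?_
          rw [h.dist_eq_left hs, h.dist_eq_left ht]
        · refine key _ fun s hs t ht => ?_
          rw [h.dist_eq_right hs, h.dist_eq_right ht, ← abs_neg]
          apply le_of_eq; congr 1; ring
        · simp
    _ = ENNReal.ofReal (4 * ε) := by
        rw [add_zero, ← ENNReal.ofReal_add (by positivity) (by positivity)]
        congr 1; ring

end Loop

/-! ### Integration over moving balls -/

/-- Integrating over balls whose centres move along a curve: if no point is `ε`-close to the curve
for a time longer than `C`, then the integral over the times of the integrals over the balls is at
most `C` times the integral over the `ε`-neighbourhood. No finiteness of `μ` is needed, since either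
the right-hand side is infinite or `f μ` is finite on the neighbourhood. -/
lemma setLIntegral_ball_le {M : Type*} [MetricSpace M] [SecondCountableTopology M]
    [MeasurableSpace M] [BorelSpace M] (μ : Measure M) (f : M → ℝ≥0∞) {σ : ℝ → M} {l ε : ℝ}
    (hl : 0 ≤ l) (hσ : ContinuousOn σ (Icc 0 l)) {C : ℝ≥0∞} (hC : C ≠ 0)
    (hvol : ∀ z, volume {s | s ∈ Icc 0 l ∧ dist z (σ s) < ε} ≤ C) :
    ∫⁻ s in Icc 0 l, (∫⁻ x in Metric.ball (σ s) ε, f x ∂μ)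
      ≤ C * ∫⁻ x in Metric.thickening ε (σ '' Icc 0 l), f x ∂μ := by
  set N := Metric.thickening ε (σ '' Icc 0 l)
  by_cases htop : ∫⁻ x in N, f x ∂μ = ⊤
  · rw [htop, ENNReal.mul_top hC]; exact le_top
  set ν : Measure M := (μ.restrict N).withDensity f with hν
  have hνuniv : ν univ = ∫⁻ x in N, f x ∂μ := by
    rw [hν, withDensity_apply _ MeasurableSet.univ, Measure.restrict_univ]
  have : IsFiniteMeasure ν := ⟨by rw [hνuniv]; exact lt_top_iff_ne_top.2 htop⟩
  have hball : ∀ s ∈ Icc 0 l, ∫⁻ x in Metric.ball (σ s) ε, f x ∂μ = ν (Metric.ball (σ s) ε) := by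
    intro s hs
    have hsub : Metric.ball (σ s) ε ⊆ N := Metric.ball_subset_thickening (mem_image_of_mem σ hs) ε
    rw [hν, withDensity_apply _ measurableSet_ball, Measure.restrict_restrict measurableSet_ball,
      inter_eq_self_of_subset_left hsub]
  set σ' : ℝ → M := IccExtend hl ((Icc 0 l).domRestrict σ)
  have hσ' : Continuous σ' := (continuousOn_iff_continuous_domRestrict.1 hσ).Icc_extend'
  have hσeq : ∀ s ∈ Icc 0 l, σ' s = σ s := fun s hs => by
    simp only [σ', IccExtend_of_mem _ _ hs, domRestrict_apply]
  set S : Set (ℝ × M) := {z | dist z.2 (σ' z.1) < ε} ∩ (Prod.fst ⁻¹' Icc 0 l)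
  have hS : MeasurableSet S :=
    (isOpen_lt (by fun_prop) continuous_const).measurableSet.inter
      (measurable_fst measurableSet_Icc)
  calc ∫⁻ s in Icc 0 l, (∫⁻ x in Metric.ball (σ s) ε, f x ∂μ)
      ≤ ∫⁻ s in Icc 0 l, ν (Prod.mk s ⁻¹' S) := by
        refine setLIntegral_mono' measurableSet_Icc fun s hs => ?_
        rw [hball s hs]
        refine measure_mono fun x hx => ⟨?_, hs⟩
        change dist x (σ' s) < ε
        rw [hσeq s hs]; exact hx
    _ ≤ ∫⁻ s, ν (Prod.mk s ⁻¹' S) := setLIntegral_le_lintegral _ _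
    _ = ∫⁻ z, volume ((fun s => (s, z)) ⁻¹' S) ∂ν := by
        rw [← Measure.prod_apply hS, Measure.prod_apply_symm hS]
    _ ≤ ∫⁻ _, C ∂ν := by
        refine lintegral_mono fun z => (measure_mono ?_).trans (hvol z)
        rintro s ⟨h1, h2⟩
        refine ⟨h2, ?_⟩
        rw [← hσeq s h2]; exact h1
    _ = C * ∫⁻ x in N, f x ∂μ := by rw [lintegral_const, hνuniv]

end RiemannianNeck

open RiemannianNeck in
theorem mainTheorem8 (n : ℕ) (M : Type*) [MetricSpace M] [SecondCountableTopology M]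
    [ChartedSpace (EuclideanSpace ℝ (Fin n)) M] [IsManifold (𝓡 n) ∞ M]
    [Bundle.RiemannianBundle (fun x : M => TangentSpace (𝓡 n) x)]
    [IsContMDiffRiemannianBundle (𝓡 n) ∞ (EuclideanSpace ℝ (Fin n))
      (fun x : M => TangentSpace (𝓡 n) x)]
    [IsRiemannianManifold (𝓡 n) M] [MeasurableSpace M] [BorelSpace M]
    (hM : IsHyperbolicSurface n M ∨ (CompleteSpace M ∧ HasNonposCurvature n M))
    (p : M) (σ : ℝ → M)
    (hσ : IsShortestGeodesicLoop n σ p (2 * (injRadius n p).toReal))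
    (ε₀ : ℝ) (hε₀ : 0 < ε₀)
    (hinj : ENNReal.ofReal (2 * ε₀) ≤
      ⨅ s ∈ Icc (0 : ℝ) (2 * (injRadius n p).toReal), injRadius n (σ s))
    (f : M → ℝ≥0∞) (hf : AEMeasurable f (riemannianVolume n M)) :
    ∫⁻ s in Icc (0 : ℝ) (2 * (injRadius n p).toReal),
        (∫⁻ x in Metric.ball (σ s) ε₀, f x ∂(riemannianVolume n M)) ≤
      ENNReal.ofReal (12 * ε₀) *
        ∫⁻ x in Metric.thickening ε₀ (σ '' Icc (0 : ℝ) (2 * (injRadius n p).toReal)),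
          f x ∂(riemannianVolume n M) := by
  have hloop := hσ.1
  refine setLIntegral_ball_le _ f hloop.1.le hloop.2.1.1.continuousOn
    (by simpa using hε₀) fun z => ?_
  exact (hloop.volume_close_le z hε₀).trans (ENNReal.ofReal_le_ofReal (by linarith))
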